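/- Let $F$ be a closed connected surface (for instance an oriented one; orientability is not needed), $I=[-1,1]$ and $N(F)=F\times I$. Let $\tau'$ be a triangulation of $F$ (a finite simplicial complex), and let its edges be oriented so that no triangle has cyclically oriented edges. Then the vertices of each triangle $T$ can be labelled $v_0,v_1,v_2$ so that its edges are oriented as $v_0v_1$, $v_1v_2$, $v_0v_2$. In $T\times I$ write $v_i$ for $(v_i,-1)$ and $w_i$ for $(v_i,1)$. The prism triangulation $\tau$ of $F\times I$ relative to $\tau'$ consists of the tetrahedra $[v_0,w_0,w_1,w_2]$, $[v_0,v_1,w_1,w_2]$, $[v_0,v_1,v_2,w_2]$ for all triangles $T$ of $\tau'$, together with their faces. A normal disc in a tetrahedron $\Delta$ is the image, under a homeomorphism of $\Delta$ that maps each face of $\Delta$ onto itself, of a flat triangle separating one vertex of $\Delta$ from the other three or of a flat quadrilateral separating two vertices from the other two. A properly embedded surface in $F\times I$ is normal (with respect to $\tau$) if it meets each tetrahedron of $\tau$ in a finite, possibly empty, disjoint union of normal discs; a closed normal surface is thus one that is disjoint from $F\times\{-1,1\}$. Two subsets $S,S'$ of $F\times I$ are normally isotopic if there is an ambient isotopy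 $(H_t)_{t\in[0,1]}$ of $F\times I$ with $H_0=\mathrm{id}$, $H_t(\sigma)=\sigma$ for every simplex $\sigma$ of $\tau$ and every $t$, and $H_1(S)=S'$. Then every closed, connected normal surface $F'\subset F\times I$ is normally isotopic to $F\times\{0\}$. -/

import Mathlib

namespace NormalSurfaces

open Set

/-! ### Triangulations -/

/-- A (finite) triangulation of a space `X`: a finite geometric simplicial complex in a normed
space together with a homeomorphism from its underlying polyhedron to `X`. -/
structure Triangulation (E X : Type*) [NormedAddCommGroup E] [NormedSpace ℝ E]
    [TopologicalSpace X] where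
  complex : Geometry.SimplicialComplex ℝ E
  finite_faces : complex.faces.Finite
  homeo : complex.space ≃ₜ X

namespace Triangulation

variable {E X : Type*} [NormedAddCommGroup E] [NormedSpace ℝ E] [TopologicalSpace X]

/-- The part of `X` that corresponds to a subset `C` of the model space. -/
def carry (τ : Triangulation E X) (C : Set E) : Set X :=
  τ.homeo '' (Subtype.val ⁻¹' C)

/-- The closed simplex of `X` with vertex set `s`. -/
def cell (τ : Triangulation E X) (s : Finset E) : Set X :=
  τ.carry (convexHull ℝ (s : Set E))

/-- The flat disc in the simplex with vertex set `s` that separates the vertices in `A` from those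
not in `A`: the points halfway between the face spanned by `A` and the opposite face,
equivalently the points whose barycentric coordinates over `A` add up to `1 / 2`. -/
def flatDisc (τ : Triangulation E X) (s A : Finset E) : Set X :=
  τ.carry (image2 (midpoint ℝ) (convexHull ℝ (A : Set E))
    (convexHull ℝ ((s : Set E) \ (A : Set E))))

/-- `D` is a disc in the simplex `s` of the same normal type as the flat disc separating `A` from
the other vertices: it is the image of that flat disc under a homeomorphism of the
simplex that maps every face of the simplex onto itself. -/
def IsDiscOfType (τ : Triangulation E X) (s A : Finset E) (D : Set X) : Prop :=
  ∃ g : τ.cell s ≃ₜ τ.cell s,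
    (∀ u ⊆ s, ∀ x : τ.cell s, (g x : X) ∈ τ.cell u ↔ (x : X) ∈ τ.cell u) ∧
    D = Subtype.val '' (g '' (Subtype.val ⁻¹' τ.flatDisc s A))

/-- A normal triangle in the tetrahedron `s`, linking the vertex `v`. -/
def IsNormalTriangle (τ : Triangulation E X) (s : Finset E) (v : E) (D : Set X) : Prop :=
  v ∈ s ∧ τ.IsDiscOfType s {v} D

/-- A normal quadrilateral in the tetrahedron `s`, linking the edge with end points in `A`
(and the opposite edge). -/
def IsNormalQuad (τ : Triangulation E X) (s A : Finset E) (D : Set X) : Prop :=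
  A ⊆ s ∧ A.card = 2 ∧ τ.IsDiscOfType s A D

/-- A normal disc in the tetrahedron `s`: a normal triangle or a normal quadrilateral. -/
def IsNormalDisc (τ : Triangulation E X) (s : Finset E) (D : Set X) : Prop :=
  (∃ v, τ.IsNormalTriangle s v D) ∨ (∃ A, τ.IsNormalQuad s A D)

/-- `S` is a normal surface in the triangulated `3`-manifold `X`: it meets each tetrahedron in a
finite (possibly empty) union of pairwise disjoint normal discs. (The tetrahedra of a triangulated
`3`-manifold cover it, and it follows that `S` is a compact surface that is properly
embedded in `X`.) -/
def IsNormalSurface (τ : Triangulation E X) (S : Set X) : Prop :=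
  ∀ s ∈ τ.complex.faces, s.card = 4 →
    ∃ 𝒟 : Set (Set X), 𝒟.Finite ∧ 𝒟.PairwiseDisjoint id ∧
      (∀ D ∈ 𝒟, τ.IsNormalDisc s D) ∧ S ∩ τ.cell s = ⋃₀ 𝒟

/-- `S` and `S'` are normally isotopic: some isotopy `H` of `X`, starting at the identity and
keeping every simplex of the triangulation invariant at all times, ends with a homeomorphism
that takes `S` onto `S'`. -/
def NormallyIsotopic (τ : Triangulation E X) (S S' : Set X) : Prop :=
  ∃ H : unitInterval → (X ≃ₜ X),
    Continuous (fun p : unitInterval × X => H p.1 p.2) ∧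
    (∀ x, H 0 x = x) ∧
    (∀ t, ∀ s ∈ τ.complex.faces, H t '' τ.cell s = τ.cell s) ∧
    H 1 '' S = S'

end Triangulation

/-- A triangulation of a surface: every simplex is a face of a triangle. -/
structure SurfaceTriangulation (E F : Type*) [NormedAddCommGroup E] [NormedSpace ℝ E]
    [TopologicalSpace F] extends Triangulation E F where
  exists_triangle : ∀ s ∈ complex.faces, ∃ t ∈ complex.faces, s ⊆ t ∧ t.card = 3

/-! ### Oriented edges -/

variable {E : Type*} [NormedAddCommGroup E] [NormedSpace ℝ E]

/-- An orientation of the edges of a simplicial complex: `dir u v` says that the edge with end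
points `u` and `v` is directed from `u` to `v`. No compatibility is asked between edges. -/
structure EdgeOrientation (K : Geometry.SimplicialComplex ℝ E) where
  dir : E → E → Prop
  xor_dir : ∀ e ∈ K.faces, ∀ u v : E, u ≠ v → (e : Set E) = {u, v} → Xor (dir u v) (dir v u)

/-- The triangle with vertex set `t` has the three vertices `v₀`, `v₁`, `v₂`, and its edges are
directed as `v₀ v₁`, `v₁ v₂`, `v₀ v₂`. -/
def EdgeOrientation.IsOrdered {K : Geometry.SimplicialComplex ℝ E} (o : EdgeOrientation K)
    (t : Finset E) (v₀ v₁ v₂ : E) : Prop :=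
  t ∈ K.faces ∧ t.card = 3 ∧ (t : Set E) = {v₀, v₁, v₂} ∧ o.dir v₀ v₁ ∧ o.dir v₁ v₂ ∧ o.dir v₀ v₂

/-- No triangle has cyclically oriented edges. -/
def EdgeOrientation.NoCyclicTriangle {K : Geometry.SimplicialComplex ℝ E}
    (o : EdgeOrientation K) : Prop :=
  ∀ t ∈ K.faces, t.card = 3 → ∀ a b c : E, (t : Set E) = {a, b, c} →
    ¬ (o.dir a b ∧ o.dir b c ∧ o.dir c a)

/-! ### The prism triangulation -/

/-- The tetrahedron `[v₀, w₀, w₁, w₂]` of the prism over `[v₀, v₁, v₂]`, where `v` is at height `-1`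
and `w` at height `1`. -/
def prismTet₀ (v₀ v₁ v₂ : E) : Set (E × ℝ) := {(v₀, -1), (v₀, 1), (v₁, 1), (v₂, 1)}

/-- The tetrahedron `[v₀, v₁, w₁, w₂]`. -/
def prismTet₁ (v₀ v₁ v₂ : E) : Set (E × ℝ) := {(v₀, -1), (v₁, -1), (v₁, 1), (v₂, 1)}

/-- The tetrahedron `[v₀, v₁, v₂, w₂]`. -/
def prismTet₂ (v₀ v₁ v₂ : E) : Set (E × ℝ) := {(v₀, -1), (v₁, -1), (v₂, -1), (v₂, 1)}

/-- The simplices of the prism triangulation: all faces of the three tetrahedra over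
each triangle. -/
def prismFaces {K : Geometry.SimplicialComplex ℝ E} (o : EdgeOrientation K) :
    Set (Finset (E × ℝ)) :=
  {s | s.Nonempty ∧ ∃ t v₀ v₁ v₂, o.IsOrdered t v₀ v₁ v₂ ∧
    ((s : Set (E × ℝ)) ⊆ prismTet₀ v₀ v₁ v₂ ∨ (s : Set (E × ℝ)) ⊆ prismTet₁ v₀ v₁ v₂ ∨
      (s : Set (E × ℝ)) ⊆ prismTet₂ v₀ v₁ v₂)}

section Aux

variable {K : Geometry.SimplicialComplex ℝ E}

theorem EdgeOrientation.antisymm (o : EdgeOrientation K) {t : Finset E} (ht : t ∈ K.faces)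
    {u v : E} (hu : u ∈ t) (hv : v ∈ t) (h₁ : u = v ∨ o.dir u v) (h₂ : v = u ∨ o.dir v u) :
    u = v := by
  classical
  by_contra hne
  have hf : ({u, v} : Finset E) ∈ K.faces := K.down_closed ht (by
    intro x hx
    simp only [Finset.mem_insert, Finset.mem_singleton] at hx
    rcases hx with rfl | rfl <;> assumption) (by simp)
  have hx := o.xor_dir _ hf u v hne (by simp)
  have h₁' := h₁.resolve_left hne
  have h₂' := h₂.resolve_left (Ne.symm hne)
  rcases hx with hx | hx
  · exact hx.2 h₂'
  · exact hx.2 h₁'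

theorem prismFaces_spec (o : EdgeOrientation K) {s : Finset (E × ℝ)} (hs : s ∈ prismFaces o) :
    ∃ t ∈ K.faces, (∀ p ∈ s, p.1 ∈ t ∧ (p.2 = -1 ∨ p.2 = 1)) ∧
      ∀ p ∈ s, ∀ q ∈ s, p.2 = -1 → q.2 = 1 → p.1 = q.1 ∨ o.dir p.1 q.1 := by
  obtain ⟨-, t, v₀, v₁, v₂, ⟨ht, -, htv, h01, h12, h02⟩, h⟩ := hs
  have m0 : v₀ ∈ t := by rw [← Finset.mem_coe, htv]; simp
  have m1 : v₁ ∈ t := by rw [← Finset.mem_coe, htv]; simp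
  have m2 : v₂ ∈ t := by rw [← Finset.mem_coe, htv]; simp
  have hne : (-1 : ℝ) ≠ 1 := by norm_num
  refine ⟨t, ht, fun p hp => ?_, fun p hp q hq hp2 hq2 => ?_⟩
  · rcases h with h | h | h <;> have hp' := h hp <;>
      simp only [prismTet₀, prismTet₁, prismTet₂, mem_insert_iff, mem_singleton_iff] at hp' <;>
      rcases hp' with rfl | rfl | rfl | rfl <;> simp [m0, m1, m2]
  · rcases h with h | h | h <;> have hp' := h hp <;> have hq' := h hq <;>
      simp only [prismTet₀, prismTet₁, prismTet₂, mem_insert_iff, mem_singleton_iff]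
        at hp' hq' <;>
      rcases hp' with rfl | rfl | rfl | rfl <;> rcases hq' with rfl | rfl | rfl | rfl <;>
      first
        | exact absurd hp2 hne.symm
        | exact absurd hq2 hne
        | simp [h01, h12, h02]

theorem affineIndependent_finset_iff {V : Type*} [AddCommGroup V] [Module ℝ V] {t : Finset V} :
    AffineIndependent ℝ ((↑) : t → V) ↔
      ∀ c : V → ℝ, ∑ v ∈ t, c v = 0 → ∑ v ∈ t, c v • v = 0 → ∀ v ∈ t, c v = 0 := by
  classical
  rw [affineIndependent_iff]
  constructor
  · intro h c h1 h2 v hv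
    refine h Finset.univ (fun v => c v) ?_ ?_ ⟨v, hv⟩ (Finset.mem_univ _)
    · rw [← h1]; exact Finset.sum_coe_sort t c
    · rw [← h2]; exact Finset.sum_coe_sort t (fun v => c v • v)
  · intro h r c h1 h2 e he
    let c' : V → ℝ := fun v => if hv : v ∈ t then (if ⟨v, hv⟩ ∈ r then c ⟨v, hv⟩ else 0) else 0
    have hc' : ∀ v : t, c' v = if v ∈ r then c v else 0 := by
      intro v; simp [c']
    have := h c' ?_ ?_ e e.2
    · rw [hc', if_pos he] at this; exact this
    · rw [← Finset.sum_coe_sort t c', ← h1]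
      simp only [hc', Finset.sum_ite_mem, Finset.univ_inter]
    · rw [← Finset.sum_coe_sort t (fun v => c' v • v), ← h2]
      simp only [hc', ite_smul, zero_smul, Finset.sum_ite_mem, Finset.univ_inter]

theorem barycentric_unique {t t' : Finset E} (ht : t ∈ K.faces) (ht' : t' ∈ K.faces)
    {a b : E → ℝ} (ha : ∀ v, 0 ≤ a v) (hb : ∀ v, 0 ≤ b v) (ha0 : ∀ v ∉ t, a v = 0)
    (hb0 : ∀ v ∉ t', b v = 0) (ha1 : ∑ v ∈ t, a v = 1) (hb1 : ∑ v ∈ t', b v = 1)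
    (hab : ∑ v ∈ t, a v • v = ∑ v ∈ t', b v • v) : a = b := by
  classical
  have hx : ∑ v ∈ t, a v • v ∈ convexHull ℝ ((t ∩ t' : Finset E) : Set E) := by
    rw [Finset.coe_inter]
    refine K.inter_subset_convexHull ht ht' ⟨?_, ?_⟩
    · exact Finset.mem_convexHull'.2 ⟨a, fun v _ => ha v, ha1, rfl⟩
    · exact Finset.mem_convexHull'.2 ⟨b, fun v _ => hb v, hb1, hab.symm⟩
  obtain ⟨y, -, hy1, hy2⟩ := Finset.mem_convexHull'.1 hx
  let z : E → ℝ := fun v => if v ∈ t ∩ t' then y v else 0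
  have key : ∀ (r : Finset E) (hr : r ∈ K.faces) (hsub : t ∩ t' ⊆ r) (d : E → ℝ)
      (hd0 : ∀ v ∉ r, d v = 0) (hd1 : ∑ v ∈ r, d v = 1)
      (hd : ∑ v ∈ r, d v • v = ∑ v ∈ t, a v • v), d = z := by
    intro r hr hsub d hd0 hd1 hd
    have e1 : ∑ v ∈ r, z v = 1 := by
      rw [← hy1]
      simp only [z, Finset.sum_ite_mem, Finset.inter_eq_right.2 hsub]
    have e2 : ∑ v ∈ r, z v • v = ∑ v ∈ t, a v • v := by
      rw [← hy2]
      simp only [z, ite_smul, zero_smul, Finset.sum_ite_mem, Finset.inter_eq_right.2 hsub]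
    have := affineIndependent_finset_iff.1 (K.indep hr) (fun v => d v - z v)
      (by rw [Finset.sum_sub_distrib, hd1, e1, sub_self])
      (by simp only [sub_smul]; rw [Finset.sum_sub_distrib, hd, e2, sub_self])
    funext v
    by_cases hv : v ∈ r
    · exact sub_eq_zero.1 (this v hv)
    · rw [hd0 v hv]
      have : v ∉ t ∩ t' := fun h => hv (hsub h)
      simp only [z, if_neg this]
  rw [key t ht Finset.inter_subset_left a ha0 ha1 rfl,
    key t' ht' Finset.inter_subset_right b hb0 hb1 hab.symm]

/-- Sums over the vertices of a prism simplex, regrouped by columns. -/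
theorem sum_columns {E M : Type*} [AddCommMonoid M] {s : Finset (E × ℝ)} {t : Finset E}
    (hst : ∀ p ∈ s, p.1 ∈ t ∧ (p.2 = -1 ∨ p.2 = 1)) (f : E × ℝ → M) (hf : ∀ p ∉ s, f p = 0) :
    ∑ p ∈ s, f p = ∑ v ∈ t, (f (v, -1) + f (v, 1)) := by
  classical
  have hsub : s ⊆ t ×ˢ ({-1, 1} : Finset ℝ) := by
    intro p hp
    simpa [Finset.mem_product] using hst p hp
  rw [Finset.sum_subset hsub (fun p _ hp => hf p hp), Finset.sum_product]
  refine Finset.sum_congr rfl fun v _ => ?_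
  rw [Finset.sum_pair (by norm_num)]

theorem sum_columns_fst {s : Finset (E × ℝ)} {t : Finset E}
    (hst : ∀ p ∈ s, p.1 ∈ t ∧ (p.2 = -1 ∨ p.2 = 1)) (c : E × ℝ → ℝ) (hc : ∀ p ∉ s, c p = 0) :
    (∑ p ∈ s, c p • p).1 = ∑ v ∈ t, (c (v, -1) + c (v, 1)) • v := by
  rw [Prod.fst_sum, sum_columns hst (fun p => (c p • p).1) (by intro p hp; simp [hc p hp])]
  simp [add_smul]

theorem sum_columns_snd {s : Finset (E × ℝ)} {t : Finset E}
    (hst : ∀ p ∈ s, p.1 ∈ t ∧ (p.2 = -1 ∨ p.2 = 1)) (c : E × ℝ → ℝ) (hc : ∀ p ∉ s, c p = 0) :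
    (∑ p ∈ s, c p • p).2 = ∑ v ∈ t, (c (v, 1) - c (v, -1)) := by
  rw [Prod.snd_sum, sum_columns hst (fun p => (c p • p).2) (by intro p hp; simp [hc p hp])]
  refine Finset.sum_congr rfl fun v _ => ?_
  simp; ring

theorem prismFaces_indep (o : EdgeOrientation K) {s : Finset (E × ℝ)} (hs : s ∈ prismFaces o) :
    AffineIndependent ℝ ((↑) : s → E × ℝ) := by
  classical
  obtain ⟨t, ht, hst, hdir⟩ := prismFaces_spec o hs
  rw [affineIndependent_finset_iff]
  intro c₀ h1 h2
  let c : E × ℝ → ℝ := fun p => if p ∈ s then c₀ p else 0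
  have hc : ∀ p ∉ s, c p = 0 := fun p hp => by simp [c, hp]
  have hcs : ∀ p ∈ s, c p = c₀ p := fun p hp => by simp [c, hp]
  have h1' : ∑ p ∈ s, c p = 0 := by rw [Finset.sum_congr rfl hcs, h1]
  have h2' : ∑ p ∈ s, c p • p = 0 := by
    rw [← h2]; exact Finset.sum_congr rfl fun p hp => by rw [hcs p hp]
  have e1 := affineIndependent_finset_iff.1 (K.indep ht) (fun v => c (v, -1) + c (v, 1))
    (by rw [← sum_columns hst c hc, h1'])
    (by rw [← sum_columns_fst hst c hc, h2']; rfl)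
  have e2 : ∑ v ∈ t, (c (v, 1) - c (v, -1)) = 0 := by
    rw [← sum_columns_snd hst c hc, h2']; rfl
  have top : ∀ v ∈ t, c (v, 1) = 0 := by
    by_contra! hcon
    obtain ⟨v, hv, hv0⟩ := hcon
    have mem : ∀ u ∈ t, c (u, 1) ≠ 0 → (u, (1 : ℝ)) ∈ s ∧ (u, (-1 : ℝ)) ∈ s := by
      intro u hu hu0
      refine ⟨by_contra fun h => hu0 (hc _ h), by_contra fun h => hu0 ?_⟩
      have := e1 u hu
      rw [hc _ h, zero_add] at this
      exact this
    have : ∀ u ∈ t, u ≠ v → c (u, 1) - c (u, -1) = 0 := by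
      intro u hu huv
      have hu0 : c (u, 1) = 0 := by
        by_contra hu0
        obtain ⟨a, b⟩ := mem u hu hu0
        obtain ⟨a', b'⟩ := mem v hv hv0
        exact huv (o.antisymm ht hu hv (hdir _ b _ a' rfl rfl) (hdir _ b' _ a rfl rfl))
      have := e1 u hu
      linarith
    rw [Finset.sum_eq_single_of_mem v hv this] at e2
    have := e1 v hv
    apply hv0
    linarith
  intro p hp
  obtain ⟨hpt, hp2⟩ := hst p hp
  rw [← hcs p hp]
  obtain ⟨v, r⟩ := p
  rcases hp2 with rfl | rfl
  · have := e1 v hpt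
    have h' := top v hpt
    linarith
  · exact top v hpt

theorem prism_barycentric_unique (o : EdgeOrientation K) {s s' : Finset (E × ℝ)}
    (hs : s ∈ prismFaces o) (hs' : s' ∈ prismFaces o) {w w' : E × ℝ → ℝ}
    (hw : ∀ p, 0 ≤ w p) (hw' : ∀ p, 0 ≤ w' p) (hw0 : ∀ p ∉ s, w p = 0)
    (hw0' : ∀ p ∉ s', w' p = 0) (hw1 : ∑ p ∈ s, w p = 1) (hw1' : ∑ p ∈ s', w' p = 1)
    (h : ∑ p ∈ s, w p • p = ∑ p ∈ s', w' p • p) : w = w' := by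
  classical
  obtain ⟨t, ht, hst, hdir⟩ := prismFaces_spec o hs
  obtain ⟨t', ht', hst', hdir'⟩ := prismFaces_spec o hs'
  have out : ∀ v, v ∉ t → ∀ r, w (v, r) = 0 := fun v hv r => hw0 _ fun hh => hv (hst _ hh).1
  have out' : ∀ v, v ∉ t' → ∀ r, w' (v, r) = 0 := fun v hv r => hw0' _ fun hh => hv (hst' _ hh).1
  have hx : (fun v => w (v, -1) + w (v, 1)) = fun v => w' (v, -1) + w' (v, 1) := by
    refine barycentric_unique ht ht' (fun v => add_nonneg (hw _) (hw _))
      (fun v => add_nonneg (hw' _) (hw' _)) (fun v hv => by simp [out v hv])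
      (fun v hv => by simp [out' v hv]) ?_ ?_ ?_
    · rw [← sum_columns hst w hw0, hw1]
    · rw [← sum_columns hst' w' hw0', hw1']
    · rw [← sum_columns_fst hst w hw0, ← sum_columns_fst hst' w' hw0', h]
  have hx' : ∀ v, w (v, -1) + w (v, 1) = w' (v, -1) + w' (v, 1) := fun v => congrFun hx v
  have hsum : ∑ v ∈ t ∪ t', w (v, 1) = ∑ v ∈ t ∪ t', w' (v, 1) := by
    have a1 : ∑ v ∈ t ∪ t', (w (v, 1) - w (v, -1)) = ∑ v ∈ t ∪ t', (w' (v, 1) - w' (v, -1)) := by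
      rw [← Finset.sum_subset Finset.subset_union_left (fun v _ hv => by simp [out v hv]),
        ← Finset.sum_subset Finset.subset_union_right (fun v _ hv => by simp [out' v hv]),
        ← sum_columns_snd hst w hw0, ← sum_columns_snd hst' w' hw0', h]
    have a2 : ∑ v ∈ t ∪ t', (w (v, -1) + w (v, 1)) = ∑ v ∈ t ∪ t', (w' (v, -1) + w' (v, 1)) :=
      Finset.sum_congr rfl fun v _ => hx' v
    simp only [Finset.sum_add_distrib, Finset.sum_sub_distrib] at a1 a2
    linarith
  have htop : ∀ v, w (v, 1) = w' (v, 1) := by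
    by_contra! hcon
    obtain ⟨v₁, hv₁⟩ := hcon
    have hv₁t : v₁ ∈ t ∪ t' := by
      by_contra hv
      rw [Finset.mem_union, not_or] at hv
      exact hv₁ (by rw [out _ hv.1, out' _ hv.2])
    obtain ⟨u, -, hu⟩ : ∃ u ∈ t ∪ t', w (u, 1) < w' (u, 1) := by
      by_contra! hle
      have := (Finset.sum_eq_sum_iff_of_le hle).1 hsum.symm v₁ hv₁t
      exact hv₁ this.symm
    obtain ⟨v, -, hv⟩ : ∃ v ∈ t ∪ t', w' (v, 1) < w (v, 1) := by
      by_contra! hle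
      have := (Finset.sum_eq_sum_iff_of_le hle).1 hsum v₁ hv₁t
      exact hv₁ this
    have m1 : (u, (1 : ℝ)) ∈ s' := by
      by_contra hh; have := hw0' _ hh; have := hw (u, 1); linarith
    have m2 : (u, (-1 : ℝ)) ∈ s := by
      by_contra hh; have := hw0 _ hh; have := hx' u; have := hw' (u, -1); linarith
    have m3 : (v, (1 : ℝ)) ∈ s := by
      by_contra hh; have := hw0 _ hh; have := hw' (v, 1); linarith
    have m4 : (v, (-1 : ℝ)) ∈ s' := by
      by_contra hh; have := hw0' _ hh; have := hx' v; have := hw (v, -1); linarith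
    have d1 := hdir _ m2 _ m3 rfl rfl
    have d2 := hdir' _ m4 _ m1 rfl rfl
    have := o.antisymm ht (hst _ m2).1 (hst _ m3).1 d1 d2
    subst this
    exact lt_asymm hu hv
  funext p
  obtain ⟨v, r⟩ := p
  by_cases hr : r = -1 ∨ r = 1
  · rcases hr with rfl | rfl
    · have := hx' v; have := htop v; linarith
    · exact htop v
  · rw [hw0 _ fun hh => hr (hst _ hh).2, hw0' _ fun hh => hr (hst' _ hh).2]

theorem prismFaces_inter (o : EdgeOrientation K) {s s' : Finset (E × ℝ)}
    (hs : s ∈ prismFaces o) (hs' : s' ∈ prismFaces o) :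
    convexHull ℝ (s : Set (E × ℝ)) ∩ convexHull ℝ (s' : Set (E × ℝ)) ⊆
      convexHull ℝ ((s : Set (E × ℝ)) ∩ s') := by
  classical
  have ext : ∀ (r : Finset (E × ℝ)) (x : E × ℝ), x ∈ convexHull ℝ (r : Set (E × ℝ)) →
      ∃ w : E × ℝ → ℝ, (∀ p, 0 ≤ w p) ∧ (∀ p ∉ r, w p = 0) ∧ ∑ p ∈ r, w p = 1 ∧
        ∑ p ∈ r, w p • p = x := by
    intro r x hx
    obtain ⟨w, h0, h1, h2⟩ := Finset.mem_convexHull'.1 hx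
    refine ⟨fun p => if p ∈ r then w p else 0, fun p => ?_, fun p hp => by simp [hp], ?_, ?_⟩
    · by_cases hp : p ∈ r <;> simp [hp, h0]
    · rw [← h1]; exact Finset.sum_congr rfl fun p hp => by simp [hp]
    · rw [← h2]; exact Finset.sum_congr rfl fun p hp => by simp [hp]
  rintro x ⟨hx, hx'⟩
  obtain ⟨w, h0, h1, h2, h3⟩ := ext s x hx
  obtain ⟨w', h0', h1', h2', h3'⟩ := ext s' x hx'
  have hww := prism_barycentric_unique o hs hs' h0 h0' h1 h1' h2 h2' (h3.trans h3'.symm)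
  subst hww
  rw [← Finset.coe_inter, Finset.mem_convexHull']
  have hz : ∀ p ∈ s, p ∉ s ∩ s' → w p = 0 := fun p hp hp' =>
    h1' p fun h => hp' (Finset.mem_inter.2 ⟨hp, h⟩)
  refine ⟨w, fun p _ => h0 p, ?_, ?_⟩
  · rw [Finset.sum_subset Finset.inter_subset_left hz, h2]
  · rw [Finset.sum_subset Finset.inter_subset_left fun p hp hp' => by rw [hz p hp hp', zero_smul],
      h3]

end Aux

/-- The prism triangulation of the product of a polyhedron with the interval `[-1, 1]`, as a
geometric simplicial complex. -/
def prismComplex {K : Geometry.SimplicialComplex ℝ E} (o : EdgeOrientation K) :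
    Geometry.SimplicialComplex ℝ (E × ℝ) where
  faces := prismFaces o
  isRelLowerSet_faces := by
    intro s hs
    refine ⟨hs.1, fun r hrs hr => ?_⟩
    obtain ⟨-, t, v₀, v₁, v₂, ho, h⟩ := hs
    have hrs' : (r : Set (E × ℝ)) ⊆ s := Finset.coe_subset.2 hrs
    exact ⟨hr, t, v₀, v₁, v₂, ho, h.imp hrs'.trans (Or.imp hrs'.trans hrs'.trans)⟩
  indep := prismFaces_indep o
  inter_subset_convexHull := prismFaces_inter o

section Space

variable {F : Type*} [TopologicalSpace F]

theorem prismFaces_finite {K : Geometry.SimplicialComplex ℝ E} (o : EdgeOrientation K)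
    (hK : K.faces.Finite) : (prismFaces o).Finite := by
  classical
  refine (hK.biUnion fun t _ =>
    ((t ×ˢ ({-1, 1} : Finset ℝ)).powerset : Finset (Finset (E × ℝ))).finite_toSet).subset ?_
  intro s hs
  obtain ⟨t, ht, hst, -⟩ := prismFaces_spec o hs
  simp only [mem_iUnion, Finset.mem_coe, Finset.mem_powerset]
  refine ⟨t, ht, fun p hp => ?_⟩
  simpa [Finset.mem_product] using hst p hp

theorem exists_ordered {K : Geometry.SimplicialComplex ℝ E} (o : EdgeOrientation K)
    (ho : o.NoCyclicTriangle) {t : Finset E} (ht : t ∈ K.faces) (h3 : t.card = 3) :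
    ∃ v₀ v₁ v₂, o.IsOrdered t v₀ v₁ v₂ := by
  classical
  obtain ⟨a, b, c, hab, hac, hbc, rfl⟩ := Finset.card_eq_three.1 h3
  have x1 := o.xor_dir {a, b} (K.down_closed ht (by intro x; simp; tauto) (by simp)) a b hab
    (by simp)
  have x2 := o.xor_dir {a, c} (K.down_closed ht (by intro x; simp; tauto) (by simp)) a c hac
    (by simp)
  have x3 := o.xor_dir {b, c} (K.down_closed ht (by intro x; simp; tauto) (by simp)) b c hbc
    (by simp)
  have c1 := ho _ ht h3 a b c (by simp)
  have c2 := ho _ ht h3 a c b (by ext x; simp; tauto)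
  have mk : ∀ x y z, ({x, y, z} : Set E) = {a, b, c} → o.dir x y → o.dir y z → o.dir x z →
      ∃ v₀ v₁ v₂, o.IsOrdered {a, b, c} v₀ v₁ v₂ := fun x y z h p q r =>
    ⟨x, y, z, ht, h3, by rw [h]; simp, p, q, r⟩
  rcases x1 with ⟨x1, -⟩ | ⟨x1, -⟩ <;> rcases x2 with ⟨x2, -⟩ | ⟨x2, -⟩ <;>
    rcases x3 with ⟨x3, -⟩ | ⟨x3, -⟩
  · exact mk a b c rfl x1 x3 x2
  · exact mk a c b (by ext x; simp; tauto) x2 x3 x1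
  · exact absurd ⟨x1, x3, x2⟩ c1
  · exact mk c a b (by ext x; simp; tauto) x2 x1 x3
  · exact mk b a c (by ext x; simp; tauto) x1 x2 x3
  · exact absurd ⟨x2, x3, x1⟩ c2
  · exact mk b c a (by ext x; simp; tauto) x3 x2 x1
  · exact mk c b a (by ext x; simp; tauto) x3 x1 x2

theorem convex_four {V : Type*} [AddCommGroup V] [Module ℝ V] {S : Set V} {a b c d : V}
    (ha : a ∈ S) (hb : b ∈ S) (hc : c ∈ S) (hd : d ∈ S) {p q r s : ℝ} (hp : 0 ≤ p) (hq : 0 ≤ q)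
    (hr : 0 ≤ r) (hs : 0 ≤ s) (h : p + q + r + s = 1) :
    p • a + q • b + r • c + s • d ∈ convexHull ℝ S := by
  have := (convex_convexHull ℝ S).sum_mem (t := Finset.univ) (w := ![p, q, r, s])
    (z := ![a, b, c, d]) (by intro i _; fin_cases i <;> simpa)
    (by simp [Fin.sum_univ_four, h])
    (by intro i _; apply subset_convexHull; fin_cases i <;> simpa)
  simpa [Fin.sum_univ_four] using this

theorem prism_cover {K : Geometry.SimplicialComplex ℝ E} (o : EdgeOrientation K) {t : Finset E}
    {v₀ v₁ v₂ : E} (h : o.IsOrdered t v₀ v₁ v₂) {x : E} (hx : x ∈ convexHull ℝ (t : Set E))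
    {r : ℝ} (hr : r ∈ Icc (-1 : ℝ) 1) : (x, r) ∈ (prismComplex o).space := by
  classical
  obtain ⟨ht, h3, htv, h01⟩ := h
  have h := h01
  have hmk : ∀ A : Finset (E × ℝ), A.Nonempty → ((A : Set (E × ℝ)) ⊆ prismTet₀ v₀ v₁ v₂ ∨
      (A : Set (E × ℝ)) ⊆ prismTet₁ v₀ v₁ v₂ ∨ (A : Set (E × ℝ)) ⊆ prismTet₂ v₀ v₁ v₂) →
      (x, r) ∈ convexHull ℝ (A : Set (E × ℝ)) → (x, r) ∈ (prismComplex o).space := by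
    intro A hA hA' hxA
    exact Geometry.SimplicialComplex.mem_space_iff.2
      ⟨A, ⟨hA, t, v₀, v₁, v₂, ⟨ht, h3, htv, h⟩, hA'⟩, hxA⟩
  have htf : t = {v₀, v₁, v₂} := by
    apply Finset.coe_injective; rw [htv]; simp
  obtain ⟨d01, d02, d12⟩ : v₀ ≠ v₁ ∧ v₀ ≠ v₂ ∧ v₁ ≠ v₂ := by
    rw [htf] at h3
    refine ⟨?_, ?_, ?_⟩ <;> rintro rfl
    · simp at h3; have := Finset.card_le_two (a := v₀) (b := v₂); omega
    · rw [Finset.insert_eq_of_mem (by simp)] at h3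
      have := Finset.card_le_two (a := v₁) (b := v₀); omega
    · simp at h3; have := Finset.card_le_two (a := v₀) (b := v₁); omega
  obtain ⟨w, hw0, hw1, hw2⟩ := Finset.mem_convexHull'.1 hx
  have n0 := hw0 v₀ (by simp [htf])
  have n1 := hw0 v₁ (by simp [htf])
  have n2 := hw0 v₂ (by simp [htf])
  rw [htf, Finset.sum_insert (by simp [d01, d02]), Finset.sum_pair d12] at hw1 hw2
  generalize w v₀ = a at *
  generalize w v₁ = b at *
  generalize w v₂ = c at *
  subst hw2
  obtain ⟨hr1, hr2⟩ := hr
  rcases le_total ((r + 1) / 2) c with hc | hc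
  · refine hmk {(v₀, -1), (v₁, -1), (v₂, -1), (v₂, 1)} (by simp)
      (Or.inr (Or.inr (by simp [prismTet₂]))) ?_
    have := convex_four (V := E × ℝ) (S := (({(v₀, -1), (v₁, -1), (v₂, -1), (v₂, 1)} :
      Finset (E × ℝ)) : Set (E × ℝ))) (a := (v₀, -1)) (b := (v₁, -1)) (c := (v₂, -1))
      (d := (v₂, 1)) (by simp) (by simp) (by simp) (by simp) n0 n1
      (r := c - (r + 1) / 2) (s := (r + 1) / 2) (by linarith) (by linarith) (by linarith)
    convert! this using 1
    ext
    · simp only [Prod.fst_add, Prod.smul_fst]; module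
    · simp only [Prod.snd_add, Prod.smul_snd, smul_eq_mul]; linarith
  · rcases le_total ((r + 1) / 2) (b + c) with hb | hb
    · refine hmk {(v₀, -1), (v₁, -1), (v₁, 1), (v₂, 1)} (by simp)
        (Or.inr (Or.inl (by simp [prismTet₁]))) ?_
      have := convex_four (V := E × ℝ) (S := (({(v₀, -1), (v₁, -1), (v₁, 1), (v₂, 1)} :
        Finset (E × ℝ)) : Set (E × ℝ))) (a := (v₀, -1)) (b := (v₁, -1)) (c := (v₁, 1))
        (d := (v₂, 1)) (by simp) (by simp) (by simp) (by simp) n0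
        (q := b + c - (r + 1) / 2) (r := (r + 1) / 2 - c) (s := c)
        (by linarith) (by linarith) (by linarith) (by linarith)
      convert! this using 1
      ext
      · simp only [Prod.fst_add, Prod.smul_fst]; module
      · simp only [Prod.snd_add, Prod.smul_snd, smul_eq_mul]; linarith
    · refine hmk {(v₀, -1), (v₀, 1), (v₁, 1), (v₂, 1)} (by simp)
        (Or.inl (by simp [prismTet₀])) ?_
      have := convex_four (V := E × ℝ) (S := (({(v₀, -1), (v₀, 1), (v₁, 1), (v₂, 1)} :
        Finset (E × ℝ)) : Set (E × ℝ))) (a := (v₀, -1)) (b := (v₀, 1)) (c := (v₁, 1))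
        (d := (v₂, 1)) (by simp) (by simp) (by simp) (by simp)
        (p := 1 - (r + 1) / 2) (q := (r + 1) / 2 - b - c) (r := b) (s := c)
        (by linarith) (by linarith) (by linarith) (by linarith) (by linarith)
      convert! this using 1
      have ha : a = 1 - b - c := by linarith
      subst ha
      ext
      · simp only [Prod.fst_add, Prod.smul_fst]; module
      · simp only [Prod.snd_add, Prod.smul_snd, smul_eq_mul]; linarith

theorem prismComplex_space (τ : SurfaceTriangulation E F) (o : EdgeOrientation τ.complex)
    (ho : o.NoCyclicTriangle) :
    (prismComplex o).space = τ.complex.space ×ˢ Icc (-1 : ℝ) 1 := by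
  apply Subset.antisymm
  · intro x hx
    obtain ⟨s, hs, hxs⟩ := Geometry.SimplicialComplex.mem_space_iff.1 hx
    obtain ⟨t, ht, hst, -⟩ := prismFaces_spec o hs
    have hsub : (s : Set (E × ℝ)) ⊆ convexHull ℝ (t : Set E) ×ˢ Icc (-1 : ℝ) 1 := by
      intro p hp
      obtain ⟨h1, h2⟩ := hst p hp
      refine ⟨subset_convexHull ℝ _ h1, ?_⟩
      rcases h2 with h2 | h2 <;> rw [h2] <;> constructor <;> norm_num
    have := convexHull_min hsub ((convex_convexHull ℝ _).prod (convex_Icc _ _)) hxs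
    exact ⟨Geometry.SimplicialComplex.mem_space_iff.2 ⟨t, ht, this.1⟩, this.2⟩
  · rintro ⟨x, r⟩ ⟨hx, hr⟩
    obtain ⟨s, hs, hxs⟩ := Geometry.SimplicialComplex.mem_space_iff.1 hx
    obtain ⟨t, ht, hst, h3⟩ := τ.exists_triangle s hs
    obtain ⟨v₀, v₁, v₂, h⟩ := exists_ordered o ho ht h3
    exact prism_cover o h (convexHull_mono (Finset.coe_subset.2 hst) hxs) hr

/-- The prism triangulation of `F × [-1, 1]` relative to a triangulation of `F` with oriented
edges and no cyclically oriented triangle. -/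
def prismTriangulation (τ : SurfaceTriangulation E F) (o : EdgeOrientation τ.complex)
    (ho : o.NoCyclicTriangle) : Triangulation (E × ℝ) (F × Icc (-1 : ℝ) 1) where
  complex := prismComplex o
  finite_faces := prismFaces_finite o τ.finite_faces
  homeo := ((Homeomorph.setCongr (prismComplex_space τ o ho)).trans
    (Homeomorph.Set.prod τ.complex.space (Icc (-1 : ℝ) 1))).trans
      (τ.homeo.prodCongr (Homeomorph.refl _))

end Space

end NormalSurfaces

/-!
# Closed normal surfaces in a prism triangulation

The height, that is the second coordinate of `F × [-1, 1]`, is linear on each simplex of the prism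
triangulation and equal to `-1` or `1` at each vertex. Every tetrahedron has vertices at both
heights. A normal disc that does not separate the vertices at height `-1` from those at height `1`
meets an edge contained in `F × {-1, 1}`. Hence a closed normal surface `S` meets each
tetrahedron in discs that are images of the zero level of the height under face-preserving
homeomorphisms (`IsNormalDisc.isLevelDisc`).

Such a disc meets every edge from height `-1` to height `1` exactly once, and by the intermediate
value theorem disjoint discs in a tetrahedron meet all these edges in the same order
(`IsLevelDisc.lt_of_lt`). So the lowest disc of a tetrahedron is well defined, and the lowest discs
of adjacent tetrahedra agree on common faces. The union of the lowest discs and the union of the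
others are closed and disjoint; as `S` is connected, each tetrahedron contains at most one disc.
Adjacent tetrahedra contain equally many, and `F × {0}` is connected, so each tetrahedron contains
exactly one disc.

It remains to turn the homeomorphisms of the single tetrahedra, which need not agree on common
faces, into an isotopy (`normallyIsotopic_of_cellwise`). In barycentric coordinates one extends the
isotopy over one simplex `u` at a time (`exists_coord_isotopy`,
`IsRadial.exists_isotopy_extension`). Let `g` be a homeomorphism of `u` that takes `S` to the zero level, and cone from an interior point
of height zero. Following `g` by the cone on the inverse of its boundary values gives a
homeomorphism that fixes the boundary and straightens `S` to the cone on its boundary. The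
Alexander trick makes it an isotopy, which is composed with the cone on the isotopy already
constructed on the boundary.
-/

namespace NormalSurfaces

open Set Filter Topology AffineMap
open scoped Pointwise

/-! ### Radial extension and the Alexander trick -/

section Star

variable {V : Type*} [AddCommGroup V] [Module ℝ V]

/-- `Q` is a compact set that is star-shaped about `c`, with radial coordinate `ρ`: it vanishes
only at `c`, is homogeneous along the rays from `c`, and `Q` consists of the points of these rays
with `ρ ≤ 1`. -/
structure IsRadial [TopologicalSpace V] (Q : Set V) (c : V) (ρ : V → ℝ) : Prop where
  isCompact : IsCompact Q
  center_mem : c ∈ Q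
  continuous : Continuous ρ
  nonneg : ∀ y ∈ Q, 0 ≤ ρ y
  le_one : ∀ y ∈ Q, ρ y ≤ 1
  eq_center : ∀ y ∈ Q, ρ y = 0 → y = c
  dilate : ∀ y ∈ Q, ∀ r, 0 ≤ r → r * ρ y ≤ 1 →
    homothety c r y ∈ Q ∧ ρ (homothety c r y) = r * ρ y

/-- The boundary of a set with a radial coordinate: the points at radius `1`. -/
def radialBoundary (Q : Set V) (ρ : V → ℝ) : Set V := {y ∈ Q | ρ y = 1}

/-- The cone from `c` on a self-map `φ` of the boundary: it keeps the radius `ρ` and acts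
as `φ` on directions. -/
noncomputable def radialExt (c : V) (ρ : V → ℝ) (φ : V → V) (y : V) : V :=
  homothety c (ρ y) (φ (homothety c (ρ y)⁻¹ y))

open Classical in
/-- The Alexander trick: `k` shrunk to the points of radius at most `t`, and the identity
elsewhere. -/
noncomputable def alexander (c : V) (ρ : V → ℝ) (k : V → V) (t : ℝ) (y : V) : V :=
  if ρ y ≤ t then homothety c t (k (homothety c t⁻¹ y)) else y

theorem homothety_homothety (c : V) (r s : ℝ) (y : V) :
    homothety c r (homothety c s y) = homothety c (r * s) y :=
  (homothety_mul_apply c r s y).symm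

theorem homothety_inv_cancel (c : V) {r : ℝ} (hr : r ≠ 0) (y : V) :
    homothety c r (homothety c r⁻¹ y) = y := by
  rw [homothety_homothety, mul_inv_cancel₀ hr]; simp

theorem homothety_inv_cancel' (c : V) {r : ℝ} (hr : r ≠ 0) (y : V) :
    homothety c r⁻¹ (homothety c r y) = y := by
  rw [homothety_homothety, inv_mul_cancel₀ hr]; simp

variable {Q : Set V} {c : V} {ρ : V → ℝ}

theorem radialExt_boundary (φ : V → V) {y : V} (hy : y ∈ radialBoundary Q ρ) :
    radialExt c ρ φ y = φ y := by
  simp [radialExt, hy.2]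

theorem alexander_boundary {k : V → V} (hk : ∀ y ∈ radialBoundary Q ρ, k y = y) {t : ℝ}
    (ht : t ∈ Icc (0 : ℝ) 1) {y : V} (hy : y ∈ radialBoundary Q ρ) :
    alexander c ρ k t y = y := by
  rw [alexander]
  split_ifs with h
  · obtain rfl : t = 1 := le_antisymm ht.2 (hy.2 ▸ h)
    simpa using hk y hy
  · rfl

variable [TopologicalSpace V]

namespace IsRadial

theorem inv_mem_boundary (hQ : IsRadial Q c ρ) {y : V} (hy : y ∈ Q) (h0 : ρ y ≠ 0) :
    homothety c (ρ y)⁻¹ y ∈ radialBoundary Q ρ := by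
  obtain ⟨h1, h2⟩ := hQ.dilate y hy (ρ y)⁻¹ (inv_nonneg.2 (hQ.nonneg y hy))
    (inv_mul_cancel₀ h0).le
  exact ⟨h1, h2.trans (inv_mul_cancel₀ h0)⟩

theorem radial_center (hQ : IsRadial Q c ρ) : ρ c = 0 := by
  simpa using (hQ.dilate c hQ.center_mem 0 le_rfl (by simp)).2

theorem radialExt_center (hQ : IsRadial Q c ρ) (φ : V → V) : radialExt c ρ φ c = c := by
  simp [radialExt, hQ.radial_center]

theorem radialExt_of_radial_eq_zero (hQ : IsRadial Q c ρ) (φ : V → V) {y : V} (hy : y ∈ Q)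
    (h0 : ρ y = 0) : radialExt c ρ φ y = y := by
  rw [hQ.eq_center y hy h0, hQ.radialExt_center]

theorem radialExt_mem (hQ : IsRadial Q c ρ) {φ : V → V}
    (hφ : MapsTo φ (radialBoundary Q ρ) (radialBoundary Q ρ)) {y : V} (hy : y ∈ Q) :
    radialExt c ρ φ y ∈ Q ∧ ρ (radialExt c ρ φ y) = ρ y := by
  by_cases h0 : ρ y = 0
  · rw [hQ.radialExt_of_radial_eq_zero φ hy h0]
    exact ⟨hy, rfl⟩
  · obtain ⟨h1, h2⟩ := hφ (hQ.inv_mem_boundary hy h0)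
    obtain ⟨h3, h4⟩ := hQ.dilate _ h1 (ρ y) (hQ.nonneg y hy)
      (by rw [h2, mul_one]; exact hQ.le_one y hy)
    exact ⟨h3, h4.trans (by rw [h2, mul_one])⟩

theorem direction_radialExt (hQ : IsRadial Q c ρ) {φ : V → V}
    (hφ : MapsTo φ (radialBoundary Q ρ) (radialBoundary Q ρ)) {y : V} (hy : y ∈ Q)
    (h0 : ρ y ≠ 0) : homothety c (ρ (radialExt c ρ φ y))⁻¹ (radialExt c ρ φ y) =
      φ (homothety c (ρ y)⁻¹ y) := by
  rw [(hQ.radialExt_mem hφ hy).2, radialExt, homothety_inv_cancel' c h0]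

theorem radialExt_leftInvOn (hQ : IsRadial Q c ρ) {φ φ' : V → V}
    (hφ : MapsTo φ (radialBoundary Q ρ) (radialBoundary Q ρ))
    (h : LeftInvOn φ' φ (radialBoundary Q ρ)) :
    LeftInvOn (radialExt c ρ φ') (radialExt c ρ φ) Q := by
  intro y hy
  by_cases h0 : ρ y = 0
  · rw [hQ.radialExt_of_radial_eq_zero φ hy h0, hQ.radialExt_of_radial_eq_zero φ' hy h0]
  · rw [radialExt, hQ.direction_radialExt hφ hy h0, (hQ.radialExt_mem hφ hy).2,
      h (hQ.inv_mem_boundary hy h0), homothety_inv_cancel c h0]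

theorem radialExt_mapsTo (hQ : IsRadial Q c ρ) {φ : V → V}
    (hφ : MapsTo φ (radialBoundary Q ρ) (radialBoundary Q ρ)) :
    MapsTo (radialExt c ρ φ) Q Q := fun _ hy => (hQ.radialExt_mem hφ hy).1

theorem alexander_mem (hQ : IsRadial Q c ρ) {k : V → V} (hk : MapsTo k Q Q) {t : ℝ}
    (ht : t ∈ Icc (0 : ℝ) 1) {y : V} (hy : y ∈ Q) :
    alexander c ρ k t y ∈ Q ∧ (ρ y ≤ t → ρ (alexander c ρ k t y) ≤ t) := by
  rw [alexander]
  split_ifs with h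
  · rcases eq_or_ne t 0 with rfl | h0
    · simp [hQ.center_mem, hQ.radial_center]
    · have hpos : 0 < t := lt_of_le_of_ne ht.1 h0.symm
      obtain ⟨h1, -⟩ := hQ.dilate y hy t⁻¹ (inv_nonneg.2 ht.1)
        (by rw [inv_mul_le_iff₀ hpos]; simpa using h)
      have h2 := hQ.le_one _ (hk h1)
      have h3 := hQ.nonneg _ (hk h1)
      obtain ⟨h4, h5⟩ := hQ.dilate _ (hk h1) t ht.1 (mul_le_one₀ ht.2 h3 h2)
      exact ⟨h4, fun _ => h5.le.trans (mul_le_of_le_one_right ht.1 h2)⟩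
  · exact ⟨hy, fun h' => absurd h' h⟩

theorem alexander_leftInvOn (hQ : IsRadial Q c ρ) {k k' : V → V} (hk : MapsTo k Q Q)
    (h : LeftInvOn k' k Q) {t : ℝ} (ht : t ∈ Icc (0 : ℝ) 1) :
    LeftInvOn (alexander c ρ k' t) (alexander c ρ k t) Q := by
  intro y hy
  by_cases hyt : ρ y ≤ t
  · have h1 := (hQ.alexander_mem hk ht hy).2 hyt
    rw [alexander, if_pos h1, alexander, if_pos hyt]
    rcases eq_or_ne t 0 with rfl | h0
    · rw [hQ.eq_center y hy (le_antisymm hyt (hQ.nonneg y hy))]; simp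
    · have hpos : 0 < t := lt_of_le_of_ne ht.1 h0.symm
      obtain ⟨h2, -⟩ := hQ.dilate y hy t⁻¹ (inv_nonneg.2 ht.1)
        (by rw [inv_mul_le_iff₀ hpos]; simpa using hyt)
      rw [homothety_inv_cancel' c h0, h h2, homothety_inv_cancel c h0]
  · rw [alexander, alexander, if_neg hyt, if_neg hyt]

theorem alexander_zero (hQ : IsRadial Q c ρ) (k : V → V) {y : V} (hy : y ∈ Q) :
    alexander c ρ k 0 y = y := by
  rw [alexander]
  split_ifs with h
  · rw [hQ.eq_center y hy (le_antisymm h (hQ.nonneg y hy))]; simp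
  · rfl

theorem alexander_one (hQ : IsRadial Q c ρ) (k : V → V) {y : V} (hy : y ∈ Q) :
    alexander c ρ k 1 y = k y := by
  rw [alexander, if_pos (hQ.le_one y hy)]; simp

end IsRadial

variable [IsTopologicalAddGroup V] [ContinuousSMul ℝ V]

/-- Dilating by a factor that tends to zero is continuous, even where the dilated map is not, as
long as that map stays in a bounded set. -/
theorem continuousOn_homothety {T : Type*} [TopologicalSpace T] {A : Set T} {Q : Set V} {c : V}
    (hQ : Bornology.IsVonNBounded ℝ Q) (hc : c ∈ Q) {r : T → ℝ} {f : T → V}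
    (hr : ContinuousOn r A) (hfQ : ∀ a ∈ A, r a ≠ 0 → f a ∈ Q)
    (hf : ContinuousOn f (A ∩ {a | r a ≠ 0})) :
    ContinuousOn (fun a => homothety c (r a) (f a)) A := by
  classical
  intro a ha
  simp only [homothety_apply, vsub_eq_sub, vadd_eq_add]
  by_cases h0 : r a = 0
  · have hev : ∀ᶠ b in 𝓝[A] a, (if r b = 0 then (0 : V) else f b - c) ∈ Q - Q := by
      filter_upwards [self_mem_nhdsWithin] with b hb
      split_ifs with h
      · exact ⟨c, hc, c, hc, sub_self c⟩
      · exact ⟨_, hfQ b hb h, c, hc, rfl⟩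
    have hr0 : Tendsto r (𝓝[A] a) (𝓝 0) := by simpa [ContinuousWithinAt, h0] using hr a ha
    have := (hQ.sub hQ).smul_tendsto_zero hev hr0
    have h2 : Tendsto (fun b => r b • (f b - c) + c) (𝓝[A] a) (𝓝 (0 + c)) := by
      refine (this.congr fun b => ?_).add_const c
      by_cases h : r b = 0 <;> simp [h]
    simpa [ContinuousWithinAt, h0] using h2
  · have hmem : {b | r b ≠ 0} ∈ 𝓝[A] a := hr a ha (isOpen_ne.mem_nhds h0)
    have hfa : ContinuousWithinAt f A a := by
      have := hf a ⟨ha, h0⟩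
      rwa [ContinuousWithinAt, nhdsWithin_inter_of_mem' hmem] at this
    exact ((hr a ha).smul (hfa.sub continuousWithinAt_const)).add continuousWithinAt_const

namespace IsRadial

theorem continuousOn_radialExt (hQ : IsRadial Q c ρ) {φ : ℝ → V → V} {I : Set ℝ}
    (hφ : ContinuousOn (fun p : ℝ × V => φ p.1 p.2) (I ×ˢ radialBoundary Q ρ))
    (hm : ∀ t ∈ I, MapsTo (φ t) (radialBoundary Q ρ) (radialBoundary Q ρ)) :
    ContinuousOn (fun p : ℝ × V => radialExt c ρ (φ p.1) p.2) (I ×ˢ Q) := by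
  refine continuousOn_homothety (hQ.isCompact.isVonNBounded ℝ) hQ.center_mem
    (hQ.continuous.comp continuous_snd).continuousOn
    (fun p hp h0 => (hm _ hp.1 (hQ.inv_mem_boundary hp.2 h0)).1) ?_
  refine hφ.comp (f := fun p : ℝ × V => (p.1, homothety c (ρ p.2)⁻¹ p.2)) ?_ ?_
  · refine continuousOn_fst.prodMk ?_
    simp only [homothety_apply, vsub_eq_sub, vadd_eq_add]
    have : ContinuousOn (fun p : ℝ × V => (ρ p.2)⁻¹) (I ×ˢ Q ∩ {a | ρ a.2 ≠ 0}) :=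
      (hQ.continuous.comp continuous_snd).continuousOn.inv₀ fun p hp => hp.2
    exact (this.smul (continuousOn_snd.sub continuousOn_const)).add continuousOn_const
  · exact fun p hp => ⟨hp.1.1, hQ.inv_mem_boundary hp.1.2 hp.2⟩

theorem continuousOn_alexander [T2Space V] (hQ : IsRadial Q c ρ) {k : V → V}
    (hk : ContinuousOn k Q) (hkQ : MapsTo k Q Q) (hkb : ∀ y ∈ radialBoundary Q ρ, k y = y) :
    ContinuousOn (fun p : ℝ × V => alexander c ρ k p.1 p.2) (Icc 0 1 ×ˢ Q) := by
  have hcl : IsClosed (Icc (0 : ℝ) 1 ×ˢ Q) := isClosed_Icc.prod hQ.isCompact.isClosed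
  have hρ : Continuous fun p : ℝ × V => ρ p.2 := hQ.continuous.comp continuous_snd
  have hsplit : Icc (0 : ℝ) 1 ×ˢ Q = (Icc (0 : ℝ) 1 ×ˢ Q ∩ {p | ρ p.2 ≤ p.1}) ∪
      (Icc (0 : ℝ) 1 ×ˢ Q ∩ {p | p.1 ≤ ρ p.2}) := by
    rw [← inter_union_distrib_left, eq_comm, inter_eq_left]
    exact fun p _ => le_total (ρ p.2) p.1
  rw [hsplit]
  have hz : ∀ p ∈ Icc (0 : ℝ) 1 ×ˢ Q ∩ {p : ℝ × V | ρ p.2 ≤ p.1}, p.1 ≠ 0 →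
      homothety c p.1⁻¹ p.2 ∈ Q := by
    intro p hp h0
    have hpos : 0 < p.1 := lt_of_le_of_ne hp.1.1.1 h0.symm
    exact (hQ.dilate p.2 hp.1.2 p.1⁻¹ (inv_nonneg.2 hpos.le)
      (by rw [inv_mul_le_iff₀ hpos]; simpa using hp.2)).1
  refine ContinuousOn.union_of_isClosed ?_ ?_ (hcl.inter (isClosed_le hρ continuous_fst))
    (hcl.inter (isClosed_le continuous_fst hρ))
  · refine ContinuousOn.congr (f := fun p : ℝ × V => homothety c p.1 (k (homothety c p.1⁻¹ p.2)))
      ?_ fun p hp => if_pos hp.2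
    refine continuousOn_homothety (hQ.isCompact.isVonNBounded ℝ) hQ.center_mem
      continuousOn_fst (fun p hp h0 => hkQ (hz p hp h0)) ?_
    refine hk.comp (f := fun p : ℝ × V => homothety c p.1⁻¹ p.2) ?_ fun p hp => hz p hp.1 hp.2
    simp only [homothety_apply, vsub_eq_sub, vadd_eq_add]
    exact ((continuousOn_fst.inv₀ fun p hp => hp.2).smul
      (continuousOn_snd.sub continuousOn_const)).add continuousOn_const
  · refine continuousOn_snd.congr fun p hp => ?_
    rcases eq_or_ne p.1 (ρ p.2) with h | h
    · simp only [alexander, if_pos h.ge]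
      rcases eq_or_ne (ρ p.2) 0 with h0 | h0
      · rw [h, h0, hQ.eq_center p.2 hp.1.2 h0]; simp
      · rw [h, hkb _ (hQ.inv_mem_boundary hp.1.2 h0), homothety_inv_cancel c h0]
    · exact if_neg (not_le.2 (lt_of_le_of_ne hp.2 h))

/-- An isotopy of the boundary that takes `S` to `Z` there extends over a radial set `Q` to one that
takes `S` to `Z` in `Q`, provided that some homeomorphism `g` of `Q` takes `S` to `Z` and that
`Z` is a union of rays from the centre. The extension is the cone on the given isotopy composed
with the Alexander isotopy of `k`, where `k` is `g` followed by the cone on the inverse of its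
boundary values: `k` fixes the boundary and straightens `S` to the cone on its boundary. -/
theorem exists_isotopy_extension [T2Space V] (hQ : IsRadial Q c ρ) {φ : ℝ → V → V} {g g' : V → V}
    {S Z : Set V}
    (hφ : ContinuousOn (fun p : ℝ × V => φ p.1 p.2) (Icc 0 1 ×ˢ radialBoundary Q ρ))
    (hφb : ∀ t ∈ Icc (0 : ℝ) 1, BijOn (φ t) (radialBoundary Q ρ) (radialBoundary Q ρ))
    (hφ0 : ∀ y ∈ radialBoundary Q ρ, φ 0 y = y)
    (hφ1 : ∀ y ∈ radialBoundary Q ρ, y ∈ S ↔ φ 1 y ∈ Z)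
    (hg : ContinuousOn g Q) (hg' : ContinuousOn g' Q) (hgQ : MapsTo g Q Q) (hgQ' : MapsTo g' Q Q)
    (hgb : MapsTo g (radialBoundary Q ρ) (radialBoundary Q ρ))
    (hgb' : MapsTo g' (radialBoundary Q ρ) (radialBoundary Q ρ)) (hgg : InvOn g' g Q Q)
    (hgS : ∀ y ∈ Q, y ∈ S ↔ g y ∈ Z)
    (hZ : ∀ y ∈ Q, y ≠ c → (homothety c (ρ y)⁻¹ y ∈ Z ↔ y ∈ Z)) :
    ∃ F : ℝ → V → V, ContinuousOn (fun p : ℝ × V => F p.1 p.2) (Icc 0 1 ×ˢ Q) ∧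
      (∀ t ∈ Icc (0 : ℝ) 1, BijOn (F t) Q Q) ∧ (∀ y ∈ Q, F 0 y = y) ∧
      (∀ t ∈ Icc (0 : ℝ) 1, ∀ y ∈ radialBoundary Q ρ, F t y = φ t y) ∧
      ∀ y ∈ Q, y ∈ S ↔ F 1 y ∈ Z := by
  have hBQ : radialBoundary Q ρ ⊆ Q := fun y hy => hy.1
  set k : V → V := radialExt c ρ g' ∘ g with hk
  set k' : V → V := g' ∘ radialExt c ρ g with hk'
  have hkQ : MapsTo k Q Q := (hQ.radialExt_mapsTo hgb').comp hgQ
  have hkQ' : MapsTo k' Q Q := hgQ'.comp (hQ.radialExt_mapsTo hgb)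
  have hkk' : LeftInvOn k' k Q := (hgg.1).comp
    (hQ.radialExt_leftInvOn hgb' (hgg.2.mono hBQ)) hgQ
  have hk'k : LeftInvOn k k' Q := (hQ.radialExt_leftInvOn hgb (hgg.1.mono hBQ)).comp
    (hgg.2) (hQ.radialExt_mapsTo hgb)
  have hkb : ∀ y ∈ radialBoundary Q ρ, k y = y := fun y hy => by
    rw [hk, Function.comp_apply, radialExt_boundary g' (hgb hy), hgg.1 hy.1]
  have hkc : ContinuousOn k Q := by
    have h1 : ContinuousOn (fun y => radialExt c ρ g' y) Q := by
      have := hQ.continuousOn_radialExt (φ := fun _ => g') (I := Icc 0 1)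
        ((hg'.mono hBQ).comp continuousOn_snd fun p hp => hp.2) (fun _ _ => hgb')
      exact this.comp (f := fun y : V => ((0 : ℝ), y)) (by fun_prop)
        fun y hy => ⟨by simp, hy⟩
    exact h1.comp hg hgQ
  refine ⟨fun t y => radialExt c ρ (φ t) (alexander c ρ k t y), ?_, ?_, ?_, ?_, ?_⟩
  · refine (hQ.continuousOn_radialExt hφ fun t ht => (hφb t ht).mapsTo).comp
      (f := fun p : ℝ × V => (p.1, alexander c ρ k p.1 p.2)) ?_ ?_
    · exact continuousOn_fst.prodMk (hQ.continuousOn_alexander hkc hkQ hkb)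
    · exact fun p hp => ⟨hp.1, (hQ.alexander_mem hkQ hp.1 hp.2).1⟩
  · intro t ht
    have hinv := (hφb t ht).invOn_invFunOn
    have hm' := ((hφb t ht).symm hinv.symm).mapsTo
    refine BijOn.comp (t := Q) (g := radialExt c ρ (φ t)) (f := alexander c ρ k t) ?_ ?_
    · exact InvOn.bijOn ⟨hQ.radialExt_leftInvOn (hφb t ht).mapsTo hinv.1,
        hQ.radialExt_leftInvOn hm' hinv.2⟩ (hQ.radialExt_mapsTo (hφb t ht).mapsTo)
        (hQ.radialExt_mapsTo hm')
    · exact InvOn.bijOn (f' := alexander c ρ k' t) ⟨hQ.alexander_leftInvOn hkQ hkk' ht,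
        hQ.alexander_leftInvOn hkQ' hk'k ht⟩ (fun y hy => (hQ.alexander_mem hkQ ht hy).1)
        (fun y hy => (hQ.alexander_mem hkQ' ht hy).1)
  · intro y hy
    simp only [hQ.alexander_zero k hy]
    by_cases h0 : ρ y = 0
    · exact hQ.radialExt_of_radial_eq_zero _ hy h0
    · rw [radialExt, hφ0 _ (hQ.inv_mem_boundary hy h0), homothety_inv_cancel c h0]
  · intro t ht y hy
    simp only [alexander_boundary hkb ht hy]
    exact radialExt_boundary _ hy
  · intro y hy
    simp only [hQ.alexander_one k hy]
    rw [hgS y hy, hk, Function.comp_apply]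
    have hz := hgQ hy
    generalize g y = z at hz
    have hw := hQ.radialExt_mem hgb' hz
    by_cases h0 : ρ z = 0
    · rw [hQ.radialExt_of_radial_eq_zero _ hz h0, hQ.radialExt_of_radial_eq_zero _ hz h0]
    have hne : ∀ x ∈ Q, ρ x = ρ z → x ≠ c := by
      rintro x - hx rfl
      exact h0 (hx ▸ hQ.radial_center)
    have hv := hQ.radialExt_mem (hφb 1 (by simp)).mapsTo hw.1
    -- `Z` can be tested on directions, where the composite is `φ 1 ∘ g'`.
    rw [← hZ _ hv.1 (hne _ hv.1 (hv.2.trans hw.2)),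
      hQ.direction_radialExt (hφb 1 (by simp)).mapsTo hw.1 (hw.2 ▸ h0),
      hQ.direction_radialExt hgb' hz h0, ← hφ1 _ (hgb' (hQ.inv_mem_boundary hz h0)),
      hgS _ (hgb' (hQ.inv_mem_boundary hz h0)).1, hgg.2 (hQ.inv_mem_boundary hz h0).1,
      hZ z hz (hne z hz rfl)]

end IsRadial

end Star
/-! ### Isotopies of simplicial complexes in barycentric coordinates -/

section Coord

variable {ι : Type*}

/-- The closed simplex with vertex set `u` in barycentric coordinates indexed by `ι`. -/
def coordCell (u : Finset ι) : Set (ι → ℝ) :=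
  {w | (∀ p, 0 ≤ w p) ∧ (∀ p ∉ u, w p = 0) ∧ ∑ p ∈ u, w p = 1}

theorem coordCell_le_one {u : Finset ι} {w : ι → ℝ} (hw : w ∈ coordCell u) (p : ι) : w p ≤ 1 := by
  by_cases hp : p ∈ u
  · rw [← hw.2.2]
    exact Finset.single_le_sum (fun q _ => hw.1 q) hp
  · rw [hw.2.1 p hp]; exact zero_le_one

theorem isCompact_coordCell (u : Finset ι) : IsCompact (coordCell u) := by
  refine (isCompact_univ_pi fun _ : ι => isCompact_Icc (a := (0 : ℝ)) (b := 1)).of_isClosed_subset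
    ?_ fun w hw p _ => ⟨hw.1 p, coordCell_le_one hw p⟩
  have h1 : IsClosed {w : ι → ℝ | ∀ p, 0 ≤ w p} := by
    simp only [ofPred_forall]
    exact isClosed_iInter fun p => isClosed_le continuous_const (continuous_apply p)
  have h2 : IsClosed {w : ι → ℝ | ∀ p ∉ u, w p = 0} := by
    simp only [ofPred_forall]
    exact isClosed_iInter fun p => isClosed_iInter fun _ =>
      isClosed_eq (continuous_apply p) continuous_const
  exact h1.inter (h2.inter (isClosed_eq (by fun_prop) continuous_const))

theorem coordCell_nonempty {u : Finset ι} {w : ι → ℝ} (hw : w ∈ coordCell u) : u.Nonempty := by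
  rw [Finset.nonempty_iff_ne_empty]
  rintro rfl
  simpa using hw.2.2

theorem coordCell_mono {u v : Finset ι} (h : u ⊆ v) : coordCell u ⊆ coordCell v := fun w hw =>
  ⟨hw.1, fun p hp => hw.2.1 p fun hp' => hp (h hp'), by
    rw [← hw.2.2, eq_comm]; exact Finset.sum_subset h fun p _ hp => hw.2.1 p hp⟩

theorem mem_coordCell_of_subset {u v : Finset ι} (h : u ⊆ v) {w : ι → ℝ} (hw : w ∈ coordCell v)
    (h0 : ∀ p ∈ v, p ∉ u → w p = 0) : w ∈ coordCell u :=
  ⟨hw.1, fun p hp => (em (p ∈ v)).elim (fun hv => h0 p hv hp) (hw.2.1 p), by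
    rw [← hw.2.2]; exact Finset.sum_subset h h0⟩

theorem mem_coordCell_inter [DecidableEq ι] {u v : Finset ι} {w : ι → ℝ} (hu : w ∈ coordCell u)
    (hv : w ∈ coordCell v) : w ∈ coordCell (u ∩ v) :=
  mem_coordCell_of_subset Finset.inter_subset_left hu fun p hp hp' =>
    hv.2.1 p fun h => hp' (Finset.mem_inter.2 ⟨hp, h⟩)

/-- The radial coordinate of a simplex about the point `c` of its interior. -/
noncomputable def simplexRadius (u : Finset ι) (hu : u.Nonempty) (c y : ι → ℝ) : ℝ :=
  u.sup' hu fun p => 1 - y p / c p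

theorem isRadial_coordCell {u : Finset ι} (hu : u.Nonempty) {c : ι → ℝ} (hc : c ∈ coordCell u)
    (hpos : ∀ p ∈ u, 0 < c p) : IsRadial (coordCell u) c (simplexRadius u hu c) := by
  have hle : ∀ {y : ι → ℝ} {r : ℝ}, simplexRadius u hu c y ≤ r ↔ ∀ p ∈ u, (1 - r) * c p ≤ y p := by
    intro y r
    rw [simplexRadius, Finset.sup'_le_iff]
    refine forall₂_congr fun p hp => ?_
    rw [sub_le_comm, le_div_iff₀ (hpos p hp)]
  -- A point of the simplex at radius `≤ 0` dominates `c` in every coordinate, hence equals `c`.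
  have heq : ∀ y ∈ coordCell u, simplexRadius u hu c y ≤ 0 → y = c := by
    intro y hy h
    have h1 : ∀ p ∈ u, c p ≤ y p := by simpa using hle.1 h
    have h2 := (Finset.sum_eq_sum_iff_of_le h1).1 (hc.2.2.trans hy.2.2.symm)
    funext p
    by_cases hp : p ∈ u
    · exact (h2 p hp).symm
    · rw [hy.2.1 p hp, hc.2.1 p hp]
  have h0 : simplexRadius u hu c c = 0 := by
    rw [simplexRadius]
    refine (Finset.sup'_congr hu rfl fun p hp => ?_).trans (Finset.sup'_const hu (0 : ℝ))
    rw [div_self (hpos p hp).ne', sub_self]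
  have hnn : ∀ y ∈ coordCell u, 0 ≤ simplexRadius u hu c y := by
    intro y hy
    by_contra! h
    have h' := h
    rw [heq y hy h.le, h0] at h'
    exact lt_irrefl _ h'
  have hhom : ∀ (y : ι → ℝ) (r : ℝ), 0 ≤ r →
      simplexRadius u hu c (homothety c r y) = r * simplexRadius u hu c y := by
    intro y r hr
    rw [simplexRadius, simplexRadius, Finset.mul₀_sup' hr]
    refine Finset.sup'_congr hu rfl fun p hp => ?_
    have := (hpos p hp).ne'
    simp only [homothety_apply, vsub_eq_sub, vadd_eq_add, Pi.add_apply, Pi.smul_apply,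
      Pi.sub_apply, smul_eq_mul]
    field_simp
    ring
  refine ⟨isCompact_coordCell u, hc, ?_, hnn, ?_, fun y hy h => heq y hy h.le, ?_⟩
  · exact Continuous.finset_sup'_apply hu fun p _ => by fun_prop
  · intro y hy
    rw [hle]
    simpa using fun p _ => hy.1 p
  · intro y hy r hr h1
    have hev : ∀ p, homothety c r y p = r * (y p - c p) + c p := fun p => by
      simp [homothety_apply]
    refine ⟨⟨fun p => ?_, fun p hp => ?_, ?_⟩, hhom y r hr⟩
    · by_cases hp : p ∈ u
      · rw [← hhom y r hr, hle] at h1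
        simpa using h1 p hp
      · rw [hev, hy.2.1 p hp, hc.2.1 p hp]; simp
    · rw [hev, hy.2.1 p hp, hc.2.1 p hp]; simp
    · simp only [hev]
      rw [Finset.sum_add_distrib, ← Finset.mul_sum, Finset.sum_sub_distrib, hy.2.2, hc.2.2]
      ring

theorem mem_radialBoundary_coordCell {u : Finset ι} (hu : u.Nonempty) {c : ι → ℝ}
    (hc : c ∈ coordCell u) (hpos : ∀ p ∈ u, 0 < c p) {y : ι → ℝ} :
    y ∈ radialBoundary (coordCell u) (simplexRadius u hu c) ↔
      y ∈ coordCell u ∧ ∃ p ∈ u, y p = 0 := by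
  refine and_congr_right fun hy => ⟨fun h => ?_, ?_⟩
  · obtain ⟨p, hp, h1⟩ := Finset.exists_mem_eq_sup' hu fun p => 1 - y p / c p
    have h2 : 1 - y p / c p = 1 := h1.symm.trans h
    refine ⟨p, hp, ?_⟩
    simpa [(hpos p hp).ne'] using h2
  · rintro ⟨p, hp, h0⟩
    refine le_antisymm ((isRadial_coordCell hu hc hpos).le_one y hy) ?_
    have h : 1 - y p / c p ≤ simplexRadius u hu c y := Finset.le_sup' (fun p => 1 - y p / c p) hp
    simpa [h0] using h

/-- The pair `g`, `g'` consists of mutually inverse homeomorphisms of the simplex `u` that map every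
face onto itself, and `g` takes `S` to `Z`. -/
structure IsCellHomeo (u : Finset ι) (S Z : Set (ι → ℝ)) (g g' : (ι → ℝ) → ι → ℝ) : Prop where
  continuousOn : ContinuousOn g (coordCell u)
  continuousOn_inv : ContinuousOn g' (coordCell u)
  mapsTo : ∀ v ⊆ u, MapsTo g (coordCell v) (coordCell v)
  mapsTo_inv : ∀ v ⊆ u, MapsTo g' (coordCell v) (coordCell v)
  invOn : InvOn g' g (coordCell u) (coordCell u)
  mem_iff : ∀ y ∈ coordCell u, y ∈ S ↔ g y ∈ Z

theorem IsCellHomeo.mono {u v : Finset ι} {S Z : Set (ι → ℝ)} {g g' : (ι → ℝ) → ι → ℝ}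
    (h : IsCellHomeo u S Z g g') (hvu : v ⊆ u) : IsCellHomeo v S Z g g' where
  continuousOn := h.continuousOn.mono (coordCell_mono hvu)
  continuousOn_inv := h.continuousOn_inv.mono (coordCell_mono hvu)
  mapsTo w hw := h.mapsTo w (hw.trans hvu)
  mapsTo_inv w hw := h.mapsTo_inv w (hw.trans hvu)
  invOn := h.invOn.mono (coordCell_mono hvu) (coordCell_mono hvu)
  mem_iff y hy := h.mem_iff y (coordCell_mono hvu hy)

/-- A map that is bijective on each simplex of a complex is injective on the whole: the common face
of two simplices is mapped onto itself. -/
theorem eq_of_bijOn_coordCell {L : Finset (Finset ι)}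
    (hdown : ∀ u ∈ L, ∀ v ⊆ u, v.Nonempty → v ∈ L) {f : (ι → ℝ) → ι → ℝ}
    (hf : ∀ u ∈ L, BijOn f (coordCell u) (coordCell u)) {u v : Finset ι} (hu : u ∈ L) (hv : v ∈ L)
    {x y : ι → ℝ} (hx : x ∈ coordCell u) (hy : y ∈ coordCell v) (h : f x = f y) : x = y := by
  classical
  have hz := mem_coordCell_inter ((hf u hu).mapsTo hx) (h ▸ (hf v hv).mapsTo hy)
  obtain ⟨z, hz', hzx⟩ := (hf _ (hdown u hu _ Finset.inter_subset_left
    (coordCell_nonempty hz))).surjOn hz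
  rw [← (hf u hu).injOn (coordCell_mono Finset.inter_subset_left hz') hx hzx]
  exact (hf v hv).injOn (coordCell_mono Finset.inter_subset_right hz') hy (hzx.trans h)

/-- If on each simplex some face-preserving homeomorphism takes `S` to `Z`, and each simplex has an
interior point from which `Z` is radial, then `S` is taken to `Z` by an isotopy that
preserves all simplices. The isotopy is extended over one simplex at a time. -/
theorem exists_coord_isotopy {S Z : Set (ι → ℝ)} (L : Finset (Finset ι))
    (hne : ∀ u ∈ L, u.Nonempty) (hdown : ∀ u ∈ L, ∀ v ⊆ u, v.Nonempty → v ∈ L)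
    (hg : ∀ u ∈ L, ∃ g g', IsCellHomeo u S Z g g')
    (hZ : ∀ u ∈ L, ∃ c ∈ coordCell u, (∀ p ∈ u, 0 < c p) ∧ ∀ y ∈ coordCell u, ∀ r : ℝ, 0 < r →
      homothety c r y ∈ coordCell u → (homothety c r y ∈ Z ↔ y ∈ Z)) :
    ∃ H : ℝ → (ι → ℝ) → ι → ℝ,
      ContinuousOn (fun p : ℝ × (ι → ℝ) => H p.1 p.2) (Icc 0 1 ×ˢ ⋃ u ∈ L, coordCell u) ∧
      (∀ t ∈ Icc (0 : ℝ) 1, ∀ u ∈ L, BijOn (H t) (coordCell u) (coordCell u)) ∧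
      (∀ u ∈ L, ∀ y ∈ coordCell u, H 0 y = y) ∧
      ∀ u ∈ L, ∀ y ∈ coordCell u, y ∈ S ↔ H 1 y ∈ Z := by
  classical
  induction L using Finset.strongInduction with
  | H L ih =>
  rcases L.eq_empty_or_nonempty with rfl | hLne
  · exact ⟨fun _ y => y, by simp, by simp, by simp, by simp⟩
  -- Without a simplex `u` of maximal size, the family is still closed under taking faces.
  obtain ⟨u, hu, hmax⟩ := L.exists_max_image Finset.card hLne
  have hdown' : ∀ v ∈ L.erase u, ∀ w ⊆ v, w.Nonempty → w ∈ L.erase u := by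
    intro v hv w hwv hw
    rw [Finset.mem_erase] at hv ⊢
    refine ⟨?_, hdown v hv.2 w hwv hw⟩
    rintro rfl
    exact hv.1 (Finset.eq_of_subset_of_card_le hwv (hmax v hv.2)).symm
  have hsub := Finset.erase_subset u L
  obtain ⟨φ, hφc, hφb, hφ0, hφ1⟩ := ih (L.erase u) (Finset.erase_ssubset hu)
    (fun v hv => hne v (hsub hv)) hdown' (fun v hv => hg v (hsub hv)) (fun v hv => hZ v (hsub hv))
  obtain ⟨c, hc, hpos, hcZ⟩ := hZ u hu
  obtain ⟨g, g', hgu⟩ := hg u hu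
  have hQ := isRadial_coordCell (hne u hu) hc hpos
  set ρ := simplexRadius u (hne u hu) c with hρ
  have hmem : ∀ {y}, y ∈ radialBoundary (coordCell u) ρ ↔ y ∈ coordCell u ∧ ∃ p ∈ u, y p = 0 :=
    mem_radialBoundary_coordCell (hne u hu) hc hpos
  -- The boundary of `u` consists of proper faces, so the given isotopy is defined on it.
  have hface : ∀ y ∈ radialBoundary (coordCell u) ρ, ∃ v ∈ L.erase u, v ⊆ u ∧ y ∈ coordCell v := by
    intro y hy
    obtain ⟨hyu, p, hp, h0⟩ := hmem.1 hy
    have hyv : y ∈ coordCell (u.erase p) := by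
      refine mem_coordCell_of_subset (Finset.erase_subset p u) hyu fun q hq hq' => ?_
      obtain rfl : q = p := by_contra fun h => hq' (Finset.mem_erase.2 ⟨h, hq⟩)
      exact h0
    refine ⟨u.erase p, Finset.mem_erase.2 ⟨?_, hdown u hu _ (Finset.erase_subset p u)
      (coordCell_nonempty hyv)⟩, Finset.erase_subset p u, hyv⟩
    exact fun h => Finset.notMem_erase p u (h.symm ▸ hp)
  have hbdry : ∀ v ∈ L.erase u, ∀ y ∈ coordCell v, y ∈ coordCell u →
      y ∈ radialBoundary (coordCell u) ρ := by
    intro v hv y hyv hyu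
    rw [Finset.mem_erase] at hv
    obtain ⟨p, hp, hpv⟩ : ∃ p ∈ u, p ∉ v := by
      by_contra! h
      exact hv.1 (Finset.eq_of_subset_of_card_le h (hmax v hv.2)).symm
    exact hmem.2 ⟨hyu, p, hp, hyv.2.1 p hpv⟩
  have hmaps : ∀ f : (ι → ℝ) → ι → ℝ, (∀ v ∈ L.erase u, v ⊆ u →
      MapsTo f (coordCell v) (coordCell v)) →
      MapsTo f (radialBoundary (coordCell u) ρ) (radialBoundary (coordCell u) ρ) := by
    intro f hf y hy
    obtain ⟨v, hv, hvu, hyv⟩ := hface y hy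
    exact hbdry v hv _ (hf v hv hvu hyv) (coordCell_mono hvu (hf v hv hvu hyv))
  have hφbd : ∀ t ∈ Icc (0 : ℝ) 1, BijOn (φ t) (radialBoundary (coordCell u) ρ)
      (radialBoundary (coordCell u) ρ) := by
    intro t ht
    refine ⟨hmaps _ fun v hv _ => (hφb t ht v hv).mapsTo, ?_, ?_⟩
    · intro x hx y hy hxy
      obtain ⟨v, hv, -, hxv⟩ := hface x hx
      obtain ⟨w, hw, -, hyw⟩ := hface y hy
      exact eq_of_bijOn_coordCell hdown' (hφb t ht) hv hw hxv hyw hxy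
    · intro y hy
      obtain ⟨v, hv, hvu, hyv⟩ := hface y hy
      obtain ⟨x, hx, rfl⟩ := (hφb t ht v hv).surjOn hyv
      exact ⟨x, hbdry v hv x hx (coordCell_mono hvu hx), rfl⟩
  have hbL : radialBoundary (coordCell u) ρ ⊆ ⋃ v ∈ L.erase u, coordCell v := by
    intro y hy
    obtain ⟨v, hv, -, hyv⟩ := hface y hy
    exact mem_biUnion hv hyv
  obtain ⟨F, hFc, hFb, hF0, hFφ, hF1⟩ := hQ.exists_isotopy_extension (φ := φ) (g := g) (g' := g')
    (S := S) (Z := Z) (hφc.mono (prod_mono_right hbL)) hφbd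
    (fun y hy => by obtain ⟨v, hv, -, hyv⟩ := hface y hy; exact hφ0 v hv y hyv)
    (fun y hy => by obtain ⟨v, hv, -, hyv⟩ := hface y hy; exact hφ1 v hv y hyv)
    hgu.continuousOn hgu.continuousOn_inv (hgu.mapsTo u subset_rfl) (hgu.mapsTo_inv u subset_rfl)
    (hmaps g fun v _ hvu => hgu.mapsTo v hvu) (hmaps g' fun v _ hvu => hgu.mapsTo_inv v hvu)
    hgu.invOn hgu.mem_iff (fun y hy hyc => by
      have h0 : ρ y ≠ 0 := fun h => hyc (hQ.eq_center y hy h)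
      exact hcZ y hy _ (inv_pos.2 (lt_of_le_of_ne (hQ.nonneg y hy) h0.symm))
        (hQ.inv_mem_boundary hy h0).1)
  have hHφ : ∀ t ∈ Icc (0 : ℝ) 1, ∀ v ∈ L.erase u, ∀ y ∈ coordCell v,
      (if y ∈ coordCell u then F t y else φ t y) = φ t y := by
    intro t ht v hv y hyv
    split_ifs with h
    · exact hFφ t ht y (hbdry v hv y hyv h)
    · rfl
  have hHF : ∀ t, ∀ y ∈ coordCell u, (if y ∈ coordCell u then F t y else φ t y) = F t y :=
    fun t y hy => if_pos hy
  have h01 : (0 : ℝ) ∈ Icc (0 : ℝ) 1 := by simp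
  have h11 : (1 : ℝ) ∈ Icc (0 : ℝ) 1 := by simp
  refine ⟨fun t y => if y ∈ coordCell u then F t y else φ t y, ?_, ?_, ?_, ?_⟩
  · rw [← Finset.insert_erase hu, Finset.set_biUnion_insert, prod_union]
    refine ContinuousOn.union_of_isClosed (hFc.congr fun p hp => hHF _ _ hp.2)
      (hφc.congr fun p hp => ?_) (isClosed_Icc.prod (isCompact_coordCell u).isClosed)
      (isClosed_Icc.prod (isClosed_biUnion_finset fun v _ => (isCompact_coordCell v).isClosed))
    obtain ⟨v, hv, hpv⟩ := mem_iUnion₂.1 hp.2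
    exact hHφ _ hp.1 v hv _ hpv
  · intro t ht v hv
    rcases eq_or_ne v u with rfl | hvu
    · exact (hFb t ht).congr fun y hy => (hHF t y hy).symm
    · have hv' := Finset.mem_erase.2 ⟨hvu, hv⟩
      exact (hφb t ht v hv').congr fun y hy => (hHφ t ht v hv' y hy).symm
  · intro v hv y hy
    rcases eq_or_ne v u with rfl | hvu
    · exact (hHF 0 y hy).trans (hF0 y hy)
    · have hv' := Finset.mem_erase.2 ⟨hvu, hv⟩
      exact (hHφ 0 h01 v hv' y hy).trans (hφ0 v hv' y hy)
  · intro v hv y hy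
    rcases eq_or_ne v u with rfl | hvu
    · simp only [hHF 1 y hy]; exact hF1 y hy
    · have hv' := Finset.mem_erase.2 ⟨hvu, hv⟩
      simp only [hHφ 1 h11 v hv' y hy]; exact hφ1 v hv' y hy

end Coord

/-! ### Barycentric coordinates on a triangulated space -/

namespace Triangulation

variable {E X : Type*} [NormedAddCommGroup E] [NormedSpace ℝ E] [TopologicalSpace X]

/-- The underlying space of a finite triangulation in barycentric coordinates. -/
def coordSpace (τ : Triangulation E X) : Set (E → ℝ) :=
  ⋃ u ∈ τ.finite_faces.toFinset, coordCell u

theorem mem_coordSpace (τ : Triangulation E X) {u : Finset E} (hu : u ∈ τ.complex.faces)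
    {w : E → ℝ} (hw : w ∈ coordCell u) : w ∈ τ.coordSpace :=
  mem_biUnion (τ.finite_faces.mem_toFinset.2 hu) hw

theorem exists_face_of_mem_coordSpace (τ : Triangulation E X) {w : E → ℝ}
    (hw : w ∈ τ.coordSpace) : ∃ u ∈ τ.complex.faces, w ∈ coordCell u := by
  obtain ⟨u, hu, h⟩ := mem_iUnion₂.1 hw
  exact ⟨u, τ.finite_faces.mem_toFinset.1 hu, h⟩

theorem mem_convexHull_iff_coordCell {u : Finset E} {x : E} :
    x ∈ convexHull ℝ (u : Set E) ↔ ∃ w ∈ coordCell u, ∑ p ∈ u, w p • p = x := by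
  classical
  rw [Finset.mem_convexHull']
  constructor
  · rintro ⟨w, h0, h1, h2⟩
    refine ⟨fun p => if p ∈ u then w p else 0, ⟨fun p => ?_, fun p hp => if_neg hp, ?_⟩, ?_⟩
    · dsimp only
      split_ifs with hp
      exacts [h0 p hp, le_rfl]
    · rw [← h1]; exact Finset.sum_congr rfl fun p hp => if_pos hp
    · rw [← h2]; exact Finset.sum_congr rfl fun p hp => by simp only [if_pos hp]
  · rintro ⟨w, hw, rfl⟩
    exact ⟨w, fun p _ => hw.1 p, hw.2.2, rfl⟩

open Classical in
/-- The point of the model space with given barycentric coordinates: the sum runs over all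
vertices of the triangulation. -/
noncomputable def combination (τ : Triangulation E X) (w : E → ℝ) : E :=
  ∑ p ∈ τ.finite_faces.toFinset.biUnion id, w p • p

theorem combination_eq (τ : Triangulation E X) {u : Finset E} (hu : u ∈ τ.complex.faces)
    {w : E → ℝ} (hw : w ∈ coordCell u) : τ.combination w = ∑ p ∈ u, w p • p := by
  classical
  refine (Finset.sum_subset ?_ fun p _ hp => by rw [hw.2.1 p hp, zero_smul]).symm
  exact fun p hp => Finset.mem_biUnion.2 ⟨u, τ.finite_faces.mem_toFinset.2 hu, hp⟩

theorem combination_mem_space (τ : Triangulation E X) {w : E → ℝ} (hw : w ∈ τ.coordSpace) :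
    τ.combination w ∈ τ.complex.space := by
  obtain ⟨u, hu, hwu⟩ := τ.exists_face_of_mem_coordSpace hw
  exact Geometry.SimplicialComplex.mem_space_iff.2
    ⟨u, hu, mem_convexHull_iff_coordCell.2 ⟨w, hwu, (τ.combination_eq hu hwu).symm⟩⟩

theorem combination_injOn (τ : Triangulation E X) : InjOn τ.combination τ.coordSpace := by
  intro w hw w' hw' h
  obtain ⟨u, hu, hwu⟩ := τ.exists_face_of_mem_coordSpace hw
  obtain ⟨u', hu', hwu'⟩ := τ.exists_face_of_mem_coordSpace hw'
  rw [τ.combination_eq hu hwu, τ.combination_eq hu' hwu'] at h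
  exact barycentric_unique hu hu' hwu.1 hwu'.1 hwu.2.1 hwu'.2.1 hwu.2.2 hwu'.2.2 h

/-- Barycentric coordinates, as a homeomorphism onto the space of coordinates. -/
theorem exists_coordHomeo (τ : Triangulation E X) :
    ∃ Φ : X ≃ₜ τ.coordSpace, ∀ w, (τ.homeo.symm (Φ.symm w) : E) = τ.combination w := by
  have hc : IsCompact τ.coordSpace :=
    τ.finite_faces.toFinset.isCompact_biUnion fun u _ => isCompact_coordCell u
  have := isCompact_iff_compactSpace.1 hc
  let f : τ.coordSpace → τ.complex.space := fun w =>
    ⟨τ.combination w, τ.combination_mem_space w.2⟩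
  have hf : Function.Bijective f := by
    refine ⟨fun w w' h => Subtype.ext (τ.combination_injOn w.2 w'.2 (Subtype.ext_iff.1 h)), ?_⟩
    rintro ⟨x, hx⟩
    obtain ⟨u, hu, hxu⟩ := Geometry.SimplicialComplex.mem_space_iff.1 hx
    obtain ⟨w, hw, rfl⟩ := mem_convexHull_iff_coordCell.1 hxu
    exact ⟨⟨w, τ.mem_coordSpace hu hw⟩, Subtype.ext (τ.combination_eq hu hw)⟩
  have hfc : Continuous f := by
    refine Continuous.subtype_mk (f := fun w : τ.coordSpace => τ.combination w) ?_ _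
    unfold combination
    exact continuous_finsetSum _ fun p _ =>
      ((continuous_apply p).comp continuous_subtype_val).smul continuous_const
  let Ψ : τ.coordSpace ≃ₜ τ.complex.space :=
    Continuous.homeoOfEquivCompactToT2 (f := Equiv.ofBijective f hf) hfc
  refine ⟨(Ψ.trans τ.homeo).symm, fun w => ?_⟩
  simp only [Homeomorph.symm_symm, Homeomorph.trans_apply, Homeomorph.symm_apply_apply]
  rfl

/-- Barycentric coordinates on a triangulated space. -/
noncomputable def coordHomeo (τ : Triangulation E X) : X ≃ₜ τ.coordSpace :=
  τ.exists_coordHomeo.choose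

theorem homeo_symm_coordHomeo_symm (τ : Triangulation E X) (w : τ.coordSpace) :
    (τ.homeo.symm (τ.coordHomeo.symm w) : E) = τ.combination w :=
  τ.exists_coordHomeo.choose_spec w

theorem mem_carry (τ : Triangulation E X) {C : Set E} {x : X} :
    x ∈ τ.carry C ↔ (τ.homeo.symm x : E) ∈ C := by
  constructor
  · rintro ⟨y, hy, rfl⟩
    simpa using hy
  · exact fun h => ⟨τ.homeo.symm x, h, by simp⟩

theorem mem_cell (τ : Triangulation E X) {u : Finset E} {x : X} :
    x ∈ τ.cell u ↔ (τ.homeo.symm x : E) ∈ convexHull ℝ (u : Set E) :=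
  τ.mem_carry

theorem cell_empty (τ : Triangulation E X) : τ.cell ∅ = ∅ := by
  ext x; simp [mem_cell]

theorem mem_cell_iff_coordHomeo (τ : Triangulation E X) {u : Finset E}
    (hu : u ∈ τ.complex.faces) {x : X} :
    x ∈ τ.cell u ↔ (τ.coordHomeo x : E → ℝ) ∈ coordCell u := by
  have hx : (τ.homeo.symm x : E) = τ.combination (τ.coordHomeo x) := by
    simpa using τ.homeo_symm_coordHomeo_symm (τ.coordHomeo x)
  rw [mem_cell, hx, mem_convexHull_iff_coordCell]
  constructor
  · rintro ⟨w, hw, h⟩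
    rw [← τ.combination_eq hu hw] at h
    rwa [← τ.combination_injOn (τ.mem_coordSpace hu hw) (τ.coordHomeo x).2 h]
  · exact fun h => ⟨_, h, (τ.combination_eq hu h).symm⟩

theorem exists_mem_cell (τ : Triangulation E X) (x : X) :
    ∃ u ∈ τ.complex.faces, x ∈ τ.cell u := by
  obtain ⟨u, hu, h⟩ := τ.exists_face_of_mem_coordSpace (τ.coordHomeo x).2
  exact ⟨u, hu, (τ.mem_cell_iff_coordHomeo hu).2 h⟩

open Classical in
/-- A self-homeomorphism of a cell, read in barycentric coordinates (and extended by the identity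
to all coordinate functions). -/
noncomputable def coordMap (τ : Triangulation E X) {s : Finset E} (hs : s ∈ τ.complex.faces)
    (g : τ.cell s ≃ₜ τ.cell s) (w : E → ℝ) : E → ℝ :=
  if h : w ∈ coordCell s then
    τ.coordHomeo (g ⟨τ.coordHomeo.symm ⟨w, τ.mem_coordSpace hs h⟩,
      (τ.mem_cell_iff_coordHomeo hs).2 (by simpa using h)⟩ : τ.cell s)
  else w

section CoordMap

variable (τ : Triangulation E X) {s : Finset E} (hs : s ∈ τ.complex.faces)

theorem coordMap_coordHomeo (g : τ.cell s ≃ₜ τ.cell s) (x : τ.cell s) :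
    τ.coordMap hs g (τ.coordHomeo x) = τ.coordHomeo (g x) := by
  rw [coordMap, dif_pos ((τ.mem_cell_iff_coordHomeo hs).1 x.2)]
  congr 4
  ext
  simp

theorem exists_coordHomeo_eq {u : Finset E} (hu : u ∈ τ.complex.faces) {w : E → ℝ}
    (hw : w ∈ coordCell u) : ∃ x ∈ τ.cell u, (τ.coordHomeo x : E → ℝ) = w := by
  refine ⟨τ.coordHomeo.symm ⟨w, τ.mem_coordSpace hu hw⟩, ?_, by simp⟩
  rw [τ.mem_cell_iff_coordHomeo hu]
  simpa using hw

theorem continuousOn_coordMap (g : τ.cell s ≃ₜ τ.cell s) :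
    ContinuousOn (τ.coordMap hs g) (coordCell s) := by
  rw [continuousOn_iff_continuous_domRestrict]
  have : (coordCell s).domRestrict (τ.coordMap hs g) = fun w : coordCell s =>
      (τ.coordHomeo (g ⟨τ.coordHomeo.symm ⟨w, τ.mem_coordSpace hs w.2⟩,
      (τ.mem_cell_iff_coordHomeo hs).2 (by simp)⟩ : τ.cell s) : E → ℝ) := by
    funext w
    exact dif_pos w.2
  rw [this]
  fun_prop

theorem mapsTo_coordMap {g : τ.cell s ≃ₜ τ.cell s}
    (hg : ∀ u ⊆ s, ∀ x : τ.cell s, (x : X) ∈ τ.cell u → (g x : X) ∈ τ.cell u) {v : Finset E}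
    (hv : v ⊆ s) : MapsTo (τ.coordMap hs g) (coordCell v) (coordCell v) := by
  intro w hw
  have hvf := τ.complex.down_closed hs hv (coordCell_nonempty hw)
  obtain ⟨x, hx, rfl⟩ := τ.exists_coordHomeo_eq hvf hw
  have hxs : x ∈ τ.cell s := (τ.mem_cell_iff_coordHomeo hs).2 (coordCell_mono hv hw)
  rw [τ.coordMap_coordHomeo hs g ⟨x, hxs⟩, ← τ.mem_cell_iff_coordHomeo hvf]
  exact hg v hv ⟨x, hxs⟩ hx

theorem isCellHomeo_coordMap {S Z : Set X} (g : τ.cell s ≃ₜ τ.cell s)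
    (hg : ∀ u ⊆ s, ∀ x : τ.cell s, (g x : X) ∈ τ.cell u ↔ (x : X) ∈ τ.cell u)
    (hgS : ∀ x : τ.cell s, (x : X) ∈ S ↔ (g x : X) ∈ Z) :
    IsCellHomeo s ((fun x => (τ.coordHomeo x : E → ℝ)) '' S)
      ((fun x => (τ.coordHomeo x : E → ℝ)) '' Z) (τ.coordMap hs g) (τ.coordMap hs g.symm) := by
  have hinj : Function.Injective fun x => (τ.coordHomeo x : E → ℝ) :=
    Subtype.val_injective.comp τ.coordHomeo.injective
  have hrep : ∀ w ∈ coordCell s, ∃ x : τ.cell s, (τ.coordHomeo x : E → ℝ) = w := fun w hw =>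
    let ⟨x, hx, h⟩ := τ.exists_coordHomeo_eq hs hw
    ⟨⟨x, hx⟩, h⟩
  refine ⟨τ.continuousOn_coordMap hs g, τ.continuousOn_coordMap hs g.symm,
    fun v hv => τ.mapsTo_coordMap hs (fun u hu x => (hg u hu x).2) hv,
    fun v hv => τ.mapsTo_coordMap hs (fun u hu x hx => ?_) hv, ⟨?_, ?_⟩, ?_⟩
  · rw [← hg u hu]; simpa using hx
  · intro w hw
    obtain ⟨x, rfl⟩ := hrep w hw
    rw [coordMap_coordHomeo, coordMap_coordHomeo, Homeomorph.symm_apply_apply]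
  · intro w hw
    obtain ⟨x, rfl⟩ := hrep w hw
    rw [coordMap_coordHomeo, coordMap_coordHomeo, Homeomorph.apply_symm_apply]
  · intro w hw
    obtain ⟨x, rfl⟩ := hrep w hw
    rw [coordMap_coordHomeo, hinj.mem_set_image (a := (x : X)),
      hinj.mem_set_image (a := (g x : X))]
    exact hgS x

end CoordMap

/-- A simplex whose vertices have heights `-1` and `1` has an interior point of height `0`, unless
all its vertices have the same height. -/
theorem exists_center {ι : Type*} {u : Finset ι} (hu : u.Nonempty) {f : ι → ℝ}
    (hf : ∀ p ∈ u, f p = -1 ∨ f p = 1) :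
    ∃ c ∈ coordCell u, (∀ p ∈ u, 0 < c p) ∧
      (∑ p ∈ u, c p * f p = 0 ∨ ∀ w ∈ coordCell u, ∑ p ∈ u, w p * f p ≠ 0) := by
  classical
  have hcard : (0 : ℝ) < u.card := by exact_mod_cast hu.card_pos
  by_cases hmix : (∃ p ∈ u, f p = -1) ∧ ∃ p ∈ u, f p = 1
  · -- Half of the total weight is spread evenly over the vertices of each height.
    obtain ⟨⟨a, ha, ha'⟩, b, hb, hb'⟩ := hmix
    set A := u.filter fun p => f p = -1
    set B := u.filter fun p => ¬ f p = -1
    have hA : (0 : ℝ) < A.card := by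
      exact_mod_cast Finset.card_pos.2 ⟨a, Finset.mem_filter.2 ⟨ha, ha'⟩⟩
    have hB : (0 : ℝ) < B.card := by
      exact_mod_cast Finset.card_pos.2 ⟨b, Finset.mem_filter.2 ⟨hb, by rw [hb']; norm_num⟩⟩
    have hsum : ∀ h : ι → ℝ, ∑ p ∈ u, h p = ∑ p ∈ A, h p + ∑ p ∈ B, h p := fun h =>
      (Finset.sum_filter_add_sum_filter_not u _ h).symm
    set c : ι → ℝ := fun p => if p ∈ u then (if f p = -1 then (2 * (A.card : ℝ))⁻¹ else
      (2 * (B.card : ℝ))⁻¹) else 0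
    have hcA : ∀ p ∈ A, c p = (2 * (A.card : ℝ))⁻¹ := fun p hp => by
      have := Finset.mem_filter.1 hp
      simp [c, this.1, this.2]
    have hcB : ∀ p ∈ B, c p = (2 * (B.card : ℝ))⁻¹ := fun p hp => by
      have := Finset.mem_filter.1 hp
      simp [c, this.1, this.2]
    have hfB : ∀ p ∈ B, f p = 1 := fun p hp => by
      have := Finset.mem_filter.1 hp
      exact (hf p this.1).resolve_left this.2
    have hpos : ∀ p ∈ u, 0 < c p := fun p hp => by
      simp only [c, if_pos hp]
      split_ifs <;> positivity
    refine ⟨c, ⟨fun p => ?_, fun p hp => if_neg hp, ?_⟩, hpos, Or.inl ?_⟩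
    · by_cases hp : p ∈ u
      exacts [(hpos p hp).le, (if_neg hp).ge]
    · rw [hsum, Finset.sum_congr rfl hcA, Finset.sum_congr rfl hcB]
      simp only [Finset.sum_const, nsmul_eq_mul]
      field_simp
      norm_num
    · have h1 : ∀ p ∈ A, c p * f p = -(2 * (A.card : ℝ))⁻¹ := fun p hp => by
        rw [hcA p hp, (Finset.mem_filter.1 hp).2, mul_neg_one]
      have h2 : ∀ p ∈ B, c p * f p = (2 * (B.card : ℝ))⁻¹ := fun p hp => by
        rw [hcB p hp, hfB p hp, mul_one]
      rw [hsum, Finset.sum_congr rfl h1, Finset.sum_congr rfl h2]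
      simp only [Finset.sum_const, nsmul_eq_mul]
      field_simp
      norm_num
  · refine ⟨fun p => if p ∈ u then (u.card : ℝ)⁻¹ else 0, ⟨fun p => ?_, fun p hp => if_neg hp, ?_⟩,
      fun p hp => ?_, Or.inr fun w hw => ?_⟩
    · dsimp only; split_ifs <;> positivity
    · rw [Finset.sum_congr rfl fun p hp => if_pos hp]
      simp [hcard.ne']
    · simp only [if_pos hp]; positivity
    · have : (∀ p ∈ u, f p = 1) ∨ ∀ p ∈ u, f p = -1 := by
        by_contra! h
        obtain ⟨⟨a, ha, ha'⟩, b, hb, hb'⟩ := h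
        exact hmix ⟨⟨a, ha, (hf a ha).resolve_right ha'⟩, b, hb, (hf b hb).resolve_left hb'⟩
      rcases this with h | h
      · rw [Finset.sum_congr rfl fun p hp => by rw [h p hp, mul_one], hw.2.2]; norm_num
      · rw [Finset.sum_congr rfl fun p hp => by rw [h p hp, mul_neg_one], Finset.sum_neg_distrib,
          hw.2.2]
        norm_num

/-- Let `ℓ` be a linear height on the model space with values `-1` and `1` at the vertices, and let
`Z` be its zero set. If every simplex lies in one that has a face-preserving homeomorphism taking
`S` to `Z`, then `S` and `Z` are normally isotopic. -/
theorem normallyIsotopic_of_cellwise [CompactSpace X] [T2Space X] (τ : Triangulation E X)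
    {S Z : Set X} (ℓ : E →ₗ[ℝ] ℝ)
    (hℓ : ∀ u ∈ τ.complex.faces, ∀ p ∈ u, ℓ p = -1 ∨ ℓ p = 1)
    (hZ : Z = {x | ℓ (τ.homeo.symm x) = 0})
    (hg : ∀ u ∈ τ.complex.faces, ∃ s ∈ τ.complex.faces, u ⊆ s ∧ ∃ g : τ.cell s ≃ₜ τ.cell s,
      (∀ u ⊆ s, ∀ x : τ.cell s, (g x : X) ∈ τ.cell u ↔ (x : X) ∈ τ.cell u) ∧
      ∀ x : τ.cell s, (x : X) ∈ S ↔ (g x : X) ∈ Z) :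
    τ.NormallyIsotopic S Z := by
  set L := τ.finite_faces.toFinset with hL
  have hLm : ∀ {u}, u ∈ L ↔ u ∈ τ.complex.faces := τ.finite_faces.mem_toFinset
  set Φ : X → E → ℝ := fun x => (τ.coordHomeo x : E → ℝ) with hΦ
  have hΦinj : Function.Injective Φ := Subtype.val_injective.comp τ.coordHomeo.injective
  have hdown : ∀ u ∈ L, ∀ v ⊆ u, v.Nonempty → v ∈ L := fun u hu v hvu hv =>
    hLm.2 (τ.complex.down_closed (hLm.1 hu) hvu hv)
  have hmemZ : ∀ u ∈ τ.complex.faces, ∀ w ∈ coordCell u,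
      w ∈ Φ '' Z ↔ ∑ p ∈ u, w p * ℓ p = 0 := by
    intro u hu w hw
    obtain ⟨x, hx, rfl⟩ := τ.exists_coordHomeo_eq hu hw
    rw [hΦinj.mem_set_image, hZ, mem_ofPred_eq]
    have h1 : (τ.homeo.symm x : E) = τ.combination (τ.coordHomeo x) := by
      simpa using τ.homeo_symm_coordHomeo_symm (τ.coordHomeo x)
    rw [h1, τ.combination_eq hu hw, map_sum]
    simp only [map_smul, smul_eq_mul]
  obtain ⟨H, hHc, hHb, hH0, hH1⟩ := exists_coord_isotopy (S := Φ '' S) (Z := Φ '' Z) L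
    (fun u hu => τ.complex.nonempty_of_mem_faces (hLm.1 hu)) hdown
    (fun u hu => by
      obtain ⟨s, hs, hus, g, hg1, hg2⟩ := hg u (hLm.1 hu)
      exact ⟨_, _, (τ.isCellHomeo_coordMap hs g hg1 hg2).mono hus⟩)
    (fun u hu => by
      obtain ⟨c, hc, hpos, h⟩ := exists_center (τ.complex.nonempty_of_mem_faces (hLm.1 hu))
        (hℓ u (hLm.1 hu))
      refine ⟨c, hc, hpos, fun y hy r hr hry => ?_⟩
      rw [hmemZ u (hLm.1 hu) _ hry, hmemZ u (hLm.1 hu) _ hy]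
      rcases h with h | h
      · have : ∑ p ∈ u, homothety c r y p * ℓ p = r * ∑ p ∈ u, y p * ℓ p := by
          have h2 : ∀ p, homothety c r y p * ℓ p = r * (y p * ℓ p) + (1 - r) * (c p * ℓ p) :=
            fun p => by simp [homothety_apply]; ring
          simp only [h2]
          rw [Finset.sum_add_distrib, ← Finset.mul_sum, ← Finset.mul_sum, h, mul_zero, add_zero]
        rw [this]
        simp [hr.ne']
      · exact iff_of_false (h _ hry) (h _ hy))
  have hHC : ∀ t ∈ Icc (0 : ℝ) 1, ∀ x, H t (Φ x) ∈ τ.coordSpace := by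
    intro t ht x
    obtain ⟨u, hu, hx⟩ := τ.exists_face_of_mem_coordSpace (τ.coordHomeo x).2
    exact τ.mem_coordSpace hu ((hHb t ht u (hLm.2 hu)).mapsTo hx)
  let G : unitInterval → X → X := fun t x => τ.coordHomeo.symm ⟨H t (Φ x), hHC t t.2 x⟩
  have hΦG : ∀ t x, Φ (G t x) = H t (Φ x) := fun t x => by simp [G, Φ]
  have hGc : Continuous fun p : unitInterval × X => G p.1 p.2 := by
    refine τ.coordHomeo.symm.continuous.comp (Continuous.subtype_mk ?_ _)
    refine hHc.comp_continuous (f := fun p : unitInterval × X => ((p.1 : ℝ), Φ p.2))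
      (by fun_prop) fun p => ⟨p.1.2, (τ.coordHomeo p.2).2⟩
  have hGcell : ∀ (t : unitInterval), ∀ u ∈ τ.complex.faces, G t '' τ.cell u = τ.cell u := by
    intro t u hu
    apply Subset.antisymm
    · rintro _ ⟨x, hx, rfl⟩
      rw [τ.mem_cell_iff_coordHomeo hu] at hx ⊢
      change Φ (G t x) ∈ _
      rw [hΦG]
      exact (hHb t t.2 u (hLm.2 hu)).mapsTo hx
    · intro y hy
      obtain ⟨w, hw, hwy⟩ := (hHb t t.2 u (hLm.2 hu)).surjOn ((τ.mem_cell_iff_coordHomeo hu).1 hy)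
      obtain ⟨x, hx, rfl⟩ := τ.exists_coordHomeo_eq hu hw
      exact ⟨x, hx, hΦinj ((hΦG t x).trans hwy)⟩
  have hGb : ∀ t, Function.Bijective (G t) := by
    intro t
    constructor
    · intro x y hxy
      obtain ⟨u, hu, hx⟩ := τ.exists_face_of_mem_coordSpace (τ.coordHomeo x).2
      obtain ⟨v, hv, hy⟩ := τ.exists_face_of_mem_coordSpace (τ.coordHomeo y).2
      refine hΦinj (eq_of_bijOn_coordCell hdown (hHb t t.2) (hLm.2 hu) (hLm.2 hv) hx hy ?_)
      rw [← hΦG, ← hΦG, hxy]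
    · intro y
      obtain ⟨u, hu, hy⟩ := τ.exists_mem_cell y
      rw [← hGcell t u hu] at hy
      obtain ⟨x, -, hx⟩ := hy
      exact ⟨x, hx⟩
  refine ⟨fun t => Continuous.homeoOfEquivCompactToT2 (f := Equiv.ofBijective (G t) (hGb t))
    (hGc.comp (Continuous.prodMk_right t)), hGc, ?_, hGcell, ?_⟩
  · intro x
    obtain ⟨u, hu, hx⟩ := τ.exists_face_of_mem_coordSpace (τ.coordHomeo x).2
    exact hΦinj ((hΦG 0 x).trans (hH0 u (hLm.2 hu) _ hx))
  · have hiff : ∀ x, x ∈ S ↔ G 1 x ∈ Z := by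
      intro x
      obtain ⟨u, hu, hx⟩ := τ.exists_face_of_mem_coordSpace (τ.coordHomeo x).2
      rw [← hΦinj.mem_set_image (a := G 1 x), hΦG, ← hΦinj.mem_set_image (a := x)]
      exact hH1 u (hLm.2 hu) _ hx
    apply Subset.antisymm
    · rintro _ ⟨x, hx, rfl⟩
      exact (hiff x).1 hx
    · intro y hy
      obtain ⟨x, rfl⟩ := (hGb 1).2 y
      exact ⟨x, (hiff x).2 hy, rfl⟩

/-! ### Cells and heights -/

/-- The height function on a triangulated space given by a functional on the model space. -/
def height (τ : Triangulation E X) (ℓ : E →L[ℝ] ℝ) (x : X) : ℝ := ℓ (τ.homeo.symm x)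

theorem continuous_height (τ : Triangulation E X) (ℓ : E →L[ℝ] ℝ) : Continuous (τ.height ℓ) :=
  ℓ.continuous.comp (continuous_subtype_val.comp τ.homeo.symm.continuous)

/-- The points of height zero. -/
def zeroLevel (τ : Triangulation E X) (ℓ : E →L[ℝ] ℝ) : Set X := {x | τ.height ℓ x = 0}

theorem isClosed_zeroLevel (τ : Triangulation E X) (ℓ : E →L[ℝ] ℝ) : IsClosed (τ.zeroLevel ℓ) :=
  isClosed_eq (τ.continuous_height ℓ) continuous_const

theorem isClosed_cell (τ : Triangulation E X) (u : Finset E) : IsClosed (τ.cell u) := by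
  have h : τ.cell u = (fun x => (τ.homeo.symm x : E)) ⁻¹' convexHull ℝ (u : Set E) := by
    ext x; exact τ.mem_cell
  rw [h]
  exact (u.finite_toSet.isCompact_convexHull ℝ).isClosed.preimage
    (continuous_subtype_val.comp τ.homeo.symm.continuous)

theorem cell_mono (τ : Triangulation E X) {u v : Finset E} (h : u ⊆ v) :
    τ.cell u ⊆ τ.cell v := fun x hx => by
  rw [mem_cell] at hx ⊢
  exact convexHull_mono (Finset.coe_subset.2 h) hx

theorem mem_cell_inter [DecidableEq E] (τ : Triangulation E X) {u v : Finset E}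
    (hu : u ∈ τ.complex.faces) (hv : v ∈ τ.complex.faces) {x : X} (hxu : x ∈ τ.cell u)
    (hxv : x ∈ τ.cell v) : x ∈ τ.cell (u ∩ v) := by
  rw [mem_cell] at hxu hxv ⊢
  rw [Finset.coe_inter]
  exact τ.complex.inter_subset_convexHull hu hv ⟨hxu, hxv⟩

theorem isPreconnected_carry (τ : Triangulation E X) {C : Set E} (hC : Convex ℝ C)
    (hCs : C ⊆ τ.complex.space) : IsPreconnected (τ.carry C) := by
  refine IsPreconnected.image ?_ _ τ.homeo.continuous.continuousOn
  rw [← IsInducing.subtypeVal.isPreconnected_image, Subtype.image_preimage_coe,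
    inter_eq_right.2 hCs]
  exact hC.isPreconnected

theorem isPreconnected_cell_inter (τ : Triangulation E X) (ℓ : E →L[ℝ] ℝ) {u : Finset E}
    (hu : u ∈ τ.complex.faces) {J : Set ℝ} (hJ : Convex ℝ J) :
    IsPreconnected (τ.cell u ∩ {x | τ.height ℓ x ∈ J}) := by
  have h : τ.cell u ∩ {x | τ.height ℓ x ∈ J} =
      τ.carry (convexHull ℝ (u : Set E) ∩ (ℓ : E →ₗ[ℝ] ℝ) ⁻¹' J) := by
    ext x
    rw [mem_carry]
    exact and_congr_left fun _ => τ.mem_cell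
  rw [h]
  exact τ.isPreconnected_carry ((convex_convexHull ℝ _).inter (hJ.linear_preimage _))
    (inter_subset_left.trans (τ.complex.convexHull_subset_space hu))

theorem eq_on_convexHull (ℓ : E →L[ℝ] ℝ) {A : Set E} {ε : ℝ} (h : ∀ p ∈ A, ℓ p = ε) {y : E}
    (hy : y ∈ convexHull ℝ A) : ℓ y = ε :=
  convexHull_min (t := {y | ℓ y = ε}) h (convex_hyperplane (f := ℓ) ℓ.toLinearMap.isLinear ε) hy

theorem height_eq_of_mem_cell (τ : Triangulation E X) (ℓ : E →L[ℝ] ℝ) {u : Finset E} {ε : ℝ}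
    (h : ∀ p ∈ u, ℓ p = ε) {x : X} (hx : x ∈ τ.cell u) : τ.height ℓ x = ε :=
  eq_on_convexHull ℓ h (τ.mem_cell.1 hx)

theorem exists_mem_cell_of_mem_convexHull (τ : Triangulation E X) {u : Finset E}
    (hu : u ∈ τ.complex.faces) {y : E} (hy : y ∈ convexHull ℝ (u : Set E)) :
    ∃ x ∈ τ.cell u, (τ.homeo.symm x : E) = y :=
  ⟨τ.homeo ⟨y, τ.complex.convexHull_subset_space hu hy⟩, τ.mem_cell.2 (by simpa using hy), by simp⟩

theorem pair_mem_faces [DecidableEq E] (τ : Triangulation E X) {s : Finset E}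
    (hs : s ∈ τ.complex.faces) {p q : E} (hp : p ∈ s) (hq : q ∈ s) :
    ({p, q} : Finset E) ∈ τ.complex.faces :=
  τ.complex.down_closed hs (by simp [Finset.insert_subset_iff, hp, hq]) (by simp)

theorem height_injOn_edge [DecidableEq E] (τ : Triangulation E X) (ℓ : E →L[ℝ] ℝ) {p q : E}
    (hp : ℓ p = -1) (hq : ℓ q = 1) : InjOn (τ.height ℓ) (τ.cell {p, q}) := by
  intro x hx y hy h
  rw [mem_cell, Finset.coe_pair, convexHull_pair] at hx hy
  obtain ⟨a, b, ha, hb, hab, hx⟩ := hx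
  obtain ⟨a', b', ha', hb', hab', hy⟩ := hy
  simp only [height, ← hx, ← hy, map_add, map_smul, smul_eq_mul, hp, hq] at h
  obtain rfl : a = a' := by linarith
  obtain rfl : b = b' := by linarith
  exact τ.homeo.symm.injective (Subtype.ext (hx.symm.trans hy))

theorem exists_mem_zeroLevel_edge [DecidableEq E] (τ : Triangulation E X) (ℓ : E →L[ℝ] ℝ) {p q : E}
    (he : ({p, q} : Finset E) ∈ τ.complex.faces) (hp : ℓ p = -1) (hq : ℓ q = 1) :
    ∃ x ∈ τ.cell {p, q}, x ∈ τ.zeroLevel ℓ := by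
  have hm : midpoint ℝ p q ∈ convexHull ℝ (({p, q} : Finset E) : Set E) := by
    rw [Finset.coe_pair, convexHull_pair]
    exact midpoint_mem_segment p q
  obtain ⟨x, hx, h⟩ := τ.exists_mem_cell_of_mem_convexHull he hm
  refine ⟨x, hx, ?_⟩
  change ℓ (τ.homeo.symm x) = 0
  rw [h, midpoint_eq_smul_add, map_smul, map_add, hp, hq]
  simp

/-- A simplex that contains a point strictly between the extreme heights has an edge joining the two
extreme heights. -/
theorem exists_crossing (τ : Triangulation E X) (ℓ : E →L[ℝ] ℝ) {u : Finset E}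
    (hℓ : ∀ p ∈ u, ℓ p = -1 ∨ ℓ p = 1) {x : X} (hx : x ∈ τ.cell u)
    (h1 : τ.height ℓ x ≠ -1) (h2 : τ.height ℓ x ≠ 1) :
    ∃ p ∈ u, ∃ q ∈ u, ℓ p = -1 ∧ ℓ q = 1 := by
  by_contra! h
  by_cases h3 : ∃ p ∈ u, ℓ p = -1
  · obtain ⟨p, hp, hp'⟩ := h3
    exact h1 (τ.height_eq_of_mem_cell ℓ
      (fun q hq => (hℓ q hq).resolve_right (h p hp q hq hp')) hx)
  · push Not at h3
    exact h2 (τ.height_eq_of_mem_cell ℓ (fun q hq => (hℓ q hq).resolve_left (h3 q hq)) hx)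

/-! ### Discs of the type of the zero level -/

/-- `D` is the image of the zero level in the simplex `s` under a face-preserving homeomorphism. -/
def IsLevelDisc (τ : Triangulation E X) (ℓ : E →L[ℝ] ℝ) (s : Finset E) (D : Set X) : Prop :=
  ∃ g : τ.cell s ≃ₜ τ.cell s,
    (∀ u ⊆ s, ∀ x : τ.cell s, (g x : X) ∈ τ.cell u ↔ (x : X) ∈ τ.cell u) ∧
    D = Subtype.val '' (g '' (Subtype.val ⁻¹' τ.zeroLevel ℓ))

/-- A flat disc that separates vertices at height `ε` from vertices at height `-ε` is the zero
level. -/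
theorem mem_flatDisc_iff (τ : Triangulation E X) (ℓ : E →L[ℝ] ℝ) {s A : Finset E} (hA : A ⊆ s)
    {ε : ℝ} (hε : ε ≠ 0) (h1 : ∀ p ∈ A, ℓ p = ε) (h2 : ∀ p ∈ s, p ∉ A → ℓ p = -ε) {x : X}
    (hx : x ∈ τ.cell s) : x ∈ τ.flatDisc s A ↔ x ∈ τ.zeroLevel ℓ := by
  classical
  rw [flatDisc, mem_carry]
  change _ ↔ ℓ (τ.homeo.symm x) = 0
  rw [mem_cell] at hx
  generalize (τ.homeo.symm x : E) = y at hx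
  constructor
  · rintro ⟨a, ha, b, hb, rfl⟩
    rw [midpoint_eq_smul_add, map_smul, map_add, eq_on_convexHull ℓ h1 ha,
      eq_on_convexHull ℓ (fun p hp => h2 p hp.1 hp.2) hb]
    simp
  · intro h0
    obtain ⟨w, hw0, hw1, rfl⟩ := Finset.mem_convexHull'.1 hx
    have hs1 : ∑ p ∈ s \ A, w p + ∑ p ∈ A, w p = 1 := by rw [Finset.sum_sdiff hA, hw1]
    have hs0 : ∑ p ∈ s \ A, w p * (-ε) + ∑ p ∈ A, w p * ε = 0 := by
      rw [map_sum, ← Finset.sum_sdiff hA] at h0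
      rw [← h0]
      congr 1
      · refine Finset.sum_congr rfl fun p hp => ?_
        rw [map_smul, h2 p (Finset.mem_sdiff.1 hp).1 (Finset.mem_sdiff.1 hp).2, smul_eq_mul]
      · refine Finset.sum_congr rfl fun p hp => ?_
        rw [map_smul, h1 p hp, smul_eq_mul]
    rw [← Finset.sum_mul, ← Finset.sum_mul] at hs0
    have hEq : ∑ p ∈ A, w p = ∑ p ∈ s \ A, w p := by
      have : (∑ p ∈ A, w p - ∑ p ∈ s \ A, w p) * ε = 0 := by linarith
      exact sub_eq_zero.1 ((mul_eq_zero.1 this).resolve_right hε)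
    refine ⟨∑ p ∈ A, (2 * w p) • p, Finset.mem_convexHull'.2 ⟨fun p => 2 * w p, fun p hp => ?_, ?_,
      rfl⟩, ∑ p ∈ s \ A, (2 * w p) • p, ?_, ?_⟩
    · have := hw0 p (hA hp); positivity
    · rw [← Finset.mul_sum]; linarith
    · rw [← Finset.coe_sdiff]
      refine Finset.mem_convexHull'.2 ⟨fun p => 2 * w p, fun p hp => ?_, ?_, rfl⟩
      · have := hw0 p (Finset.mem_sdiff.1 hp).1; positivity
      · rw [← Finset.mul_sum]; linarith
    · rw [midpoint_eq_smul_add, ← Finset.sum_sdiff hA, add_comm (∑ p ∈ A, _), smul_add,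
        Finset.smul_sum, Finset.smul_sum]
      simp only [smul_smul]
      simp

/-- A normal disc that avoids the extreme heights separates the vertices at height `-1` from those
at height `1`: otherwise it meets an edge that lies at an extreme height. -/
theorem IsNormalDisc.isLevelDisc {τ : Triangulation E X} {ℓ : E →L[ℝ] ℝ} {s : Finset E}
    (hs : s ∈ τ.complex.faces) (hcard : s.card = 4) (hℓ : ∀ p ∈ s, ℓ p = -1 ∨ ℓ p = 1)
    {D : Set X} (hD : τ.IsNormalDisc s D)
    (havoid : ∀ x ∈ D, τ.height ℓ x ≠ -1 ∧ τ.height ℓ x ≠ 1) : τ.IsLevelDisc ℓ s D := by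
  classical
  obtain ⟨A, hAs, hA, hA', g, hg, rfl⟩ : ∃ A ⊆ s, A.Nonempty ∧ (s \ A).Nonempty ∧
      τ.IsDiscOfType s A D := by
    rcases hD with ⟨v, hv, h⟩ | ⟨A, hA, hA2, h⟩
    · refine ⟨{v}, by simpa using hv, by simp, ?_, by simpa using h⟩
      rw [← Finset.card_pos, Finset.card_sdiff_of_subset (by simpa using hv)]
      simp [hcard]
    · refine ⟨A, hA, by rw [← Finset.card_pos]; omega, ?_, h⟩
      rw [← Finset.card_pos, Finset.card_sdiff_of_subset hA]
      omega
  have hne : ∀ p ∈ A, ∀ q ∈ s, q ∉ A → ℓ p ≠ ℓ q := by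
    intro p hp q hq hqA h
    have hsub : ({p, q} : Finset E) ⊆ s := by simp [Finset.insert_subset_iff, hAs hp, hq]
    have hm : midpoint ℝ p q ∈ convexHull ℝ (({p, q} : Finset E) : Set E) := by
      rw [Finset.coe_pair, convexHull_pair]
      exact midpoint_mem_segment p q
    obtain ⟨x, hx, hxm⟩ :=
      τ.exists_mem_cell_of_mem_convexHull (τ.pair_mem_faces hs (hAs hp) hq) hm
    let x' : τ.cell s := ⟨x, τ.cell_mono hsub hx⟩
    have hflat : x ∈ τ.flatDisc s A := by
      rw [flatDisc, mem_carry, hxm]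
      exact ⟨p, subset_convexHull ℝ _ hp, q, subset_convexHull ℝ _ ⟨hq, hqA⟩, rfl⟩
    have h1 := havoid (g x') ⟨_, ⟨x', hflat, rfl⟩, rfl⟩
    have h2 : τ.height ℓ (g x') = ℓ p :=
      τ.height_eq_of_mem_cell ℓ (by simp [h]) ((hg _ hsub x').2 hx)
    rw [h2] at h1
    exact (hℓ p (hAs hp)).elim h1.1 h1.2
  obtain ⟨p₀, hp₀⟩ := hA
  obtain ⟨q₀, hq₀⟩ := hA'
  rw [Finset.mem_sdiff] at hq₀
  have hopp : ∀ p ∈ s, ∀ q ∈ s, ℓ p ≠ ℓ q → ℓ q = -ℓ p := by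
    intro p hp q hq h
    rcases hℓ p hp with h1 | h1 <;> rcases hℓ q hq with h2 | h2 <;> rw [h1, h2] at h <;>
      first | exact absurd rfl h | norm_num [h1, h2]
  have hB : ∀ q ∈ s, q ∉ A → ℓ q = -ℓ p₀ := fun q hq hqA =>
    hopp p₀ (hAs hp₀) q hq (hne p₀ hp₀ q hq hqA)
  have hAε : ∀ p ∈ A, ℓ p = ℓ p₀ := fun p hp => by
    have h1 := hopp p (hAs hp) q₀ hq₀.1 (hne p hp q₀ hq₀.1 hq₀.2)
    have h2 := hB q₀ hq₀.1 hq₀.2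
    linarith
  have hε : ℓ p₀ ≠ 0 := by rcases hℓ p₀ (hAs hp₀) with h | h <;> rw [h] <;> norm_num
  refine ⟨g, hg, ?_⟩
  congr 2
  ext x
  exact τ.mem_flatDisc_iff ℓ hAs hε hAε hB x.2

namespace IsLevelDisc

variable {τ : Triangulation E X} {ℓ : E →L[ℝ] ℝ} {s : Finset E} {D D₁ D₂ : Set X}

theorem subset_cell (hD : τ.IsLevelDisc ℓ s D) : D ⊆ τ.cell s := by
  obtain ⟨g, -, rfl⟩ := hD
  rintro _ ⟨x, -, rfl⟩
  exact x.2

theorem isClosed (hD : τ.IsLevelDisc ℓ s D) : IsClosed D := by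
  obtain ⟨g, -, rfl⟩ := hD
  exact (τ.isClosed_cell s).isClosedMap_subtype_val _ (g.isClosedMap _
    ((τ.isClosed_zeroLevel ℓ).preimage continuous_subtype_val))

theorem isPreconnected_inter (hD : τ.IsLevelDisc ℓ s D) {u : Finset E}
    (hu : u ∈ τ.complex.faces) (hus : u ⊆ s) : IsPreconnected (D ∩ τ.cell u) := by
  obtain ⟨g, hg, rfl⟩ := hD
  have h : Subtype.val '' (g '' (Subtype.val ⁻¹' τ.zeroLevel ℓ)) ∩ τ.cell u =
      Subtype.val '' (g '' (Subtype.val ⁻¹' (τ.cell u ∩ {x | τ.height ℓ x ∈ ({0} : Set ℝ)}))) := by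
    ext y
    constructor
    · rintro ⟨⟨_, ⟨x, hx, rfl⟩, rfl⟩, hy⟩
      exact ⟨_, ⟨x, ⟨(hg u hus x).1 hy, hx⟩, rfl⟩, rfl⟩
    · rintro ⟨_, ⟨x, hx, rfl⟩, rfl⟩
      exact ⟨⟨_, ⟨x, hx.2, rfl⟩, rfl⟩, (hg u hus x).2 hx.1⟩
  rw [h]
  refine (IsPreconnected.image ?_ _ g.continuous.continuousOn).image _
    continuous_subtype_val.continuousOn
  rw [← IsInducing.subtypeVal.isPreconnected_image, Subtype.image_preimage_coe,
    inter_eq_right.2 (inter_subset_left.trans (τ.cell_mono hus))]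
  exact τ.isPreconnected_cell_inter ℓ hu (convex_singleton 0)

theorem exists_mem_edge [DecidableEq E] (hD : τ.IsLevelDisc ℓ s D) (hs : s ∈ τ.complex.faces)
    {p q : E} (hp : p ∈ s) (hq : q ∈ s) (hp1 : ℓ p = -1) (hq1 : ℓ q = 1) :
    ∃ y ∈ D, y ∈ τ.cell {p, q} := by
  obtain ⟨g, hg, rfl⟩ := hD
  have hsub : ({p, q} : Finset E) ⊆ s := by simp [Finset.insert_subset_iff, hp, hq]
  obtain ⟨x, hx, hx0⟩ := τ.exists_mem_zeroLevel_edge ℓ (τ.pair_mem_faces hs hp hq) hp1 hq1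
  let x' : τ.cell s := ⟨x, τ.cell_mono hsub hx⟩
  exact ⟨g x', ⟨_, ⟨x', hx0, rfl⟩, rfl⟩, (hg _ hsub x').2 hx⟩

theorem eq_of_mem_edge [DecidableEq E] (hD : τ.IsLevelDisc ℓ s D)
    {p q : E} (hp : p ∈ s) (hq : q ∈ s) (hp1 : ℓ p = -1) (hq1 : ℓ q = 1) {y z : X}
    (hy : y ∈ D) (hye : y ∈ τ.cell {p, q}) (hz : z ∈ D) (hze : z ∈ τ.cell {p, q}) : y = z := by
  obtain ⟨g, hg, rfl⟩ := hD
  have hsub : ({p, q} : Finset E) ⊆ s := by simp [Finset.insert_subset_iff, hp, hq]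
  obtain ⟨_, ⟨x, hx, rfl⟩, rfl⟩ := hy
  obtain ⟨_, ⟨x', hx', rfl⟩, rfl⟩ := hz
  have h1 := (hg _ hsub x).1 hye
  have h2 := (hg _ hsub x').1 hze
  rw [Subtype.ext (τ.height_injOn_edge ℓ hp1 hq1 h1 h2 (Eq.trans hx (Eq.symm hx')))]

/-- A level disc is the zero set of a function on its simplex that agrees with the height at
the vertices. -/
theorem exists_function (hD : τ.IsLevelDisc ℓ s D) : ∃ φ : X → ℝ, ContinuousOn φ (τ.cell s) ∧
    (∀ x ∈ τ.cell s, x ∈ D ↔ φ x = 0) ∧ ∀ p ∈ s, ∀ x ∈ τ.cell {p}, φ x = ℓ p := by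
  obtain ⟨g, hg, rfl⟩ := hD
  set φ : X → ℝ := Function.extend Subtype.val (fun x => τ.height ℓ (g.symm x)) 0
  have hφ : ∀ x : τ.cell s, φ x = τ.height ℓ (g.symm x) := fun x =>
    Subtype.val_injective.extend_apply _ _ x
  refine ⟨φ, ?_, fun x hx => ?_, fun p hp x hx => ?_⟩
  · rw [continuousOn_iff_continuous_domRestrict]
    exact ((τ.continuous_height ℓ).comp (continuous_subtype_val.comp g.symm.continuous)).congr
      fun x => (hφ x).symm
  · rw [hφ ⟨x, hx⟩]
    constructor
    · rintro ⟨_, ⟨z, hz, rfl⟩, rfl⟩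
      simpa [zeroLevel] using hz
    · exact fun h => ⟨⟨x, hx⟩, ⟨g.symm ⟨x, hx⟩, h, by simp⟩, rfl⟩
  · have hsub : ({p} : Finset E) ⊆ s := by simpa using hp
    rw [hφ ⟨x, τ.cell_mono hsub hx⟩]
    refine τ.height_eq_of_mem_cell ℓ (u := {p}) (by simp) ((hg _ hsub _).1 ?_)
    simpa using hx

/-- On an edge that joins the two extreme heights, the defining function of a level disc is negative
below the disc and positive above it. -/
theorem sign_on_edge [DecidableEq E] (hD : τ.IsLevelDisc ℓ s D) (hs : s ∈ τ.complex.faces)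
    {φ : X → ℝ} (hφ : ContinuousOn φ (τ.cell s)) (hφD : ∀ x ∈ τ.cell s, x ∈ D ↔ φ x = 0)
    (hφv : ∀ p ∈ s, ∀ x ∈ τ.cell {p}, φ x = ℓ p)
    {p q : E} (hp : p ∈ s) (hq : q ∈ s) (hp1 : ℓ p = -1) (hq1 : ℓ q = 1) {x y : X}
    (hy : y ∈ D) (hye : y ∈ τ.cell {p, q}) (hx : x ∈ τ.cell {p, q}) :
    (τ.height ℓ x < τ.height ℓ y → φ x < 0) ∧ (τ.height ℓ y < τ.height ℓ x → 0 < φ x) := by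
  have hsub : ({p, q} : Finset E) ⊆ s := by simp [Finset.insert_subset_iff, hp, hq]
  have he := τ.pair_mem_faces hs hp hq
  have hvert : ∀ r ∈ ({p, q} : Finset E), ∃ z ∈ τ.cell {r}, z ∈ τ.cell {p, q} ∧
      τ.height ℓ z = ℓ r := by
    intro r hr
    have hr' : ({r} : Finset E) ⊆ {p, q} := by simpa using hr
    obtain ⟨z, hz, -⟩ := τ.exists_mem_cell_of_mem_convexHull
      (τ.complex.down_closed he hr' (by simp)) (y := r) (by simp)
    exact ⟨z, hz, τ.cell_mono hr' hz, τ.height_eq_of_mem_cell ℓ (by simp) hz⟩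
  have hrange : -1 ≤ τ.height ℓ x ∧ τ.height ℓ x ≤ 1 := by
    have h1 := (τ.mem_cell.1 hx)
    refine convexHull_min (t := {y | ℓ y ∈ Icc (-1 : ℝ) 1}) ?_
      ((convex_Icc (-1 : ℝ) 1).linear_preimage (ℓ : E →ₗ[ℝ] ℝ)) h1
    intro r hr
    rcases (by simpa using hr : r = p ∨ r = q) with rfl | rfl
    · simp [hp1]
    · simp [hq1]
  constructor <;> intro hlt <;> by_contra! hcon
  · -- Otherwise the function vanishes on the part of the edge at or below `x`, so `y` lies there.
    obtain ⟨z, hz, hze, hzh⟩ := hvert p (by simp)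
    have hB := τ.isPreconnected_cell_inter ℓ he (convex_Iic (τ.height ℓ x))
    obtain ⟨b, ⟨hbe, hbh⟩, hb0⟩ := hB.intermediate_value (a := z) (b := x)
      ⟨hze, by rw [mem_ofPred_eq, hzh, hp1]; exact hrange.1⟩ ⟨hx, le_refl (τ.height ℓ x)⟩
      (hφ.mono (inter_subset_left.trans (τ.cell_mono hsub)))
      (show (0 : ℝ) ∈ Icc (φ z) (φ x) from ⟨by rw [hφv p hp z hz, hp1]; norm_num, hcon⟩)
    have := hD.eq_of_mem_edge hp hq hp1 hq1 hy hye
      ((hφD b (τ.cell_mono hsub hbe)).2 hb0) hbe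
    subst this
    exact absurd hbh (not_le.2 hlt)
  · obtain ⟨z, hz, hze, hzh⟩ := hvert q (by simp)
    have hB := τ.isPreconnected_cell_inter ℓ he (convex_Ici (τ.height ℓ x))
    obtain ⟨b, ⟨hbe, hbh⟩, hb0⟩ := hB.intermediate_value (a := x) (b := z)
      ⟨hx, le_refl (τ.height ℓ x)⟩ ⟨hze, by rw [mem_ofPred_eq, hzh, hq1]; exact hrange.2⟩
      (hφ.mono (inter_subset_left.trans (τ.cell_mono hsub)))
      (show (0 : ℝ) ∈ Icc (φ x) (φ z) from ⟨hcon, by rw [hφv q hq z hz, hq1]; norm_num⟩)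
    have := hD.eq_of_mem_edge hp hq hp1 hq1 hy hye
      ((hφD b (τ.cell_mono hsub hbe)).2 hb0) hbe
    subst this
    exact absurd hbh (not_le.2 hlt)

/-- Two disjoint level discs of a simplex meet all edges that join the extreme heights in the
same order. -/
theorem lt_of_lt [DecidableEq E] (hD₁ : τ.IsLevelDisc ℓ s D₁) (hD₂ : τ.IsLevelDisc ℓ s D₂)
    (hs : s ∈ τ.complex.faces) (hdis : Disjoint D₁ D₂)
    {p q p' q' : E} (hp : p ∈ s) (hq : q ∈ s) (hp1 : ℓ p = -1) (hq1 : ℓ q = 1)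
    (hp' : p' ∈ s) (hq' : q' ∈ s) (hp1' : ℓ p' = -1) (hq1' : ℓ q' = 1) {y₁ y₂ z₁ z₂ : X}
    (hy₁ : y₁ ∈ D₁) (hy₁e : y₁ ∈ τ.cell {p, q}) (hy₂ : y₂ ∈ D₂) (hy₂e : y₂ ∈ τ.cell {p, q})
    (hz₁ : z₁ ∈ D₁) (hz₁e : z₁ ∈ τ.cell {p', q'}) (hz₂ : z₂ ∈ D₂) (hz₂e : z₂ ∈ τ.cell {p', q'})
    (hlt : τ.height ℓ y₁ < τ.height ℓ y₂) : τ.height ℓ z₁ < τ.height ℓ z₂ := by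
  by_contra! hcon
  have hlt' : τ.height ℓ z₂ < τ.height ℓ z₁ := lt_of_le_of_ne hcon fun h =>
    disjoint_left.1 hdis hz₁ (τ.height_injOn_edge ℓ hp1' hq1' hz₂e hz₁e h ▸ hz₂)
  obtain ⟨φ, hφ, hφD, hφv⟩ := hD₁.exists_function
  have h1 := (hD₁.sign_on_edge hs hφ hφD hφv hp hq hp1 hq1 hy₁ hy₁e hy₂e).2 hlt
  have h2 := (hD₁.sign_on_edge hs hφ hφD hφv hp' hq' hp1' hq1' hz₁ hz₁e hz₂e).1 hlt'
  have hpre := hD₂.isPreconnected_inter hs subset_rfl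
  rw [inter_eq_left.2 hD₂.subset_cell] at hpre
  obtain ⟨b, hb, hb0⟩ := hpre.intermediate_value hz₂ hy₂ (hφ.mono hD₂.subset_cell)
    ⟨h2.le, h1.le⟩
  exact disjoint_left.1 hdis ((hφD b (hD₂.subset_cell hb)).2 hb0) hb

end IsLevelDisc

end Triangulation

/-! ### A connected normal surface has one disc in each tetrahedron -/

/-- A preconnected set covered by a finite family of pairwise disjoint closed sets lies in each
member of the family that it meets. -/
theorem IsPreconnected.subset_of_mem_of_finite {X : Type*} [TopologicalSpace X] {C : Set X}
    (hC : IsPreconnected C) {𝒟 : Set (Set X)} (hfin : 𝒟.Finite) (hdis : 𝒟.PairwiseDisjoint id)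
    (hcl : ∀ D ∈ 𝒟, IsClosed D) (hcov : C ⊆ ⋃₀ 𝒟) {D : Set X} (hD : D ∈ 𝒟) {x : X} (hxC : x ∈ C)
    (hxD : x ∈ D) : C ⊆ D := by
  have hrest : IsClosed (⋃₀ (𝒟 \ {D})) := by
    rw [sUnion_eq_biUnion]
    exact (hfin.subset sdiff_subset).isClosed_biUnion fun D' hD' => hcl D' hD'.1
  have hnot : ∀ y ∈ D, y ∉ ⋃₀ (𝒟 \ {D}) := by
    rintro y hy ⟨D', hD', hy'⟩
    exact disjoint_left.1 (hdis hD hD'.1 (Ne.symm hD'.2)) hy hy'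
  have hcov' : C ⊆ D ∪ ⋃₀ (𝒟 \ {D}) := by
    intro y hy
    obtain ⟨D', hD', hy'⟩ := hcov hy
    by_cases h : D' = D
    · exact Or.inl (h ▸ hy')
    · exact Or.inr ⟨D', ⟨hD', h⟩, hy'⟩
  rcases isPreconnected_iff_subset_of_disjoint_closed.1 hC D _ (hcl D hD) hrest hcov'
    (by ext y; simp only [mem_inter_iff, mem_empty_iff_false, iff_false]
        exact fun h => hnot y h.2.1 h.2.2) with h | h
  · exact h
  · exact absurd (h hxC) (hnot x hxD)

namespace Triangulation

variable {E X : Type*} [NormedAddCommGroup E] [NormedSpace ℝ E] [TopologicalSpace X]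

/-- A decomposition of a set `S` into level discs: `𝒟 s` is the family of discs in which `S` meets
the tetrahedron `s`. Here `T` is a set of simplices that plays the role of the tetrahedra: every
simplex is a face of one in `T`, and those in `T` have vertices at both extreme heights. -/
structure IsDiscDecomposition (τ : Triangulation E X) (ℓ : E →L[ℝ] ℝ) (S : Set X)
    (T : Set (Finset E)) (𝒟 : Finset E → Set (Set X)) : Prop where
  faces : T ⊆ τ.complex.faces
  covers : ∀ u ∈ τ.complex.faces, ∃ s ∈ T, u ⊆ s
  height_vertex : ∀ u ∈ τ.complex.faces, ∀ p ∈ u, ℓ p = -1 ∨ ℓ p = 1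
  crossing : ∀ s ∈ T, ∃ p ∈ s, ∃ q ∈ s, ℓ p = -1 ∧ ℓ q = 1
  height_ne : ∀ x ∈ S, τ.height ℓ x ≠ -1 ∧ τ.height ℓ x ≠ 1
  finite : ∀ s ∈ T, (𝒟 s).Finite
  pairwiseDisjoint : ∀ s ∈ T, (𝒟 s).PairwiseDisjoint id
  isLevelDisc : ∀ s ∈ T, ∀ D ∈ 𝒟 s, τ.IsLevelDisc ℓ s D
  inter_cell : ∀ s ∈ T, S ∩ τ.cell s = ⋃₀ 𝒟 s

open Classical in
/-- The disc `D` is the lowest one of `S` on some edge of `s` that joins the extreme heights. -/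
def IsLowest (τ : Triangulation E X) (ℓ : E →L[ℝ] ℝ) (S : Set X) (s : Finset E) (D : Set X) :
    Prop :=
  ∃ p ∈ s, ∃ q ∈ s, ℓ p = -1 ∧ ℓ q = 1 ∧ ∃ y ∈ D, y ∈ τ.cell {p, q} ∧
    ∀ y' ∈ S, y' ∈ τ.cell {p, q} → τ.height ℓ y ≤ τ.height ℓ y'

namespace IsDiscDecomposition

variable {τ : Triangulation E X} {ℓ : E →L[ℝ] ℝ} {S : Set X} {T : Set (Finset E)}
  {𝒟 : Finset E → Set (Set X)}

theorem subset_surface (h : τ.IsDiscDecomposition ℓ S T 𝒟) {s : Finset E} (hs : s ∈ T) {D : Set X}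
    (hD : D ∈ 𝒟 s) : D ⊆ S := fun _ hx =>
  ((h.inter_cell s hs).symm.subset ⟨D, hD, hx⟩).1

theorem exists_disc (h : τ.IsDiscDecomposition ℓ S T 𝒟) {s : Finset E} (hs : s ∈ T) {x : X}
    (hx : x ∈ S) (hxs : x ∈ τ.cell s) : ∃ D ∈ 𝒟 s, x ∈ D :=
  (h.inter_cell s hs).subset ⟨hx, hxs⟩

theorem exists_tetrahedron (h : τ.IsDiscDecomposition ℓ S T 𝒟) (x : X) :
    ∃ s ∈ T, x ∈ τ.cell s := by
  obtain ⟨u, hu, hx⟩ := τ.exists_mem_cell x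
  obtain ⟨s, hs, hus⟩ := h.covers u hu
  exact ⟨s, hs, τ.cell_mono hus hx⟩

theorem finite_tetrahedra (h : τ.IsDiscDecomposition ℓ S T 𝒟) : T.Finite :=
  τ.finite_faces.subset h.faces

/-- A disc that is lowest on one crossing edge is lowest on every crossing edge. -/
theorem height_le (h : τ.IsDiscDecomposition ℓ S T 𝒟) [DecidableEq E] {s : Finset E} (hs : s ∈ T)
    {D : Set X} (hD : D ∈ 𝒟 s) (hlow : τ.IsLowest ℓ S s D) {p q : E} (hp : p ∈ s) (hq : q ∈ s)
    (hp1 : ℓ p = -1) (hq1 : ℓ q = 1) {y y' : X} (hy : y ∈ D) (hye : y ∈ τ.cell {p, q})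
    (hy' : y' ∈ S) (hye' : y' ∈ τ.cell {p, q}) : τ.height ℓ y ≤ τ.height ℓ y' := by
  obtain ⟨a, ha, b, hb, ha1, hb1, z, hz, hze, hzmin⟩ := hlow
  have hsub : ∀ {a b : E}, a ∈ s → b ∈ s → ({a, b} : Finset E) ⊆ s := fun ha hb => by
    simp [Finset.insert_subset_iff, ha, hb]
  have hsf := h.faces hs
  have hDl := h.isLevelDisc s hs D hD
  obtain ⟨D', hD', hyD'⟩ := h.exists_disc hs hy' (τ.cell_mono (hsub hp hq) hye')
  have hDl' := h.isLevelDisc s hs D' hD'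
  rcases eq_or_ne D D' with rfl | hne
  · exact (congrArg _ (hDl.eq_of_mem_edge hp hq hp1 hq1 hy hye hyD' hye')).le
  · have hdis : Disjoint D D' := h.pairwiseDisjoint s hs hD hD' hne
    obtain ⟨z', hz', hze'⟩ := hDl'.exists_mem_edge hsf ha hb ha1 hb1
    have hze2 : z ∈ τ.cell {a, b} := by convert hze
    have hle : τ.height ℓ z ≤ τ.height ℓ z' :=
      hzmin z' (h.subset_surface hs hD' hz') (by convert hze')
    have hlt : τ.height ℓ z < τ.height ℓ z' := lt_of_le_of_ne hle fun he =>
      disjoint_left.1 hdis hz (τ.height_injOn_edge ℓ ha1 hb1 hze2 hze' he ▸ hz')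
    exact (hDl.lt_of_lt hDl' hsf hdis ha hb ha1 hb1 hp hq hp1 hq1 hz hze2 hz' hze' hy hye hyD'
      hye' hlt).le

theorem exists_isLowest (h : τ.IsDiscDecomposition ℓ S T 𝒟) {s : Finset E} (hs : s ∈ T)
    (hne : (𝒟 s).Nonempty) : ∃ D ∈ 𝒟 s, τ.IsLowest ℓ S s D := by
  classical
  obtain ⟨p, hp, q, hq, hp1, hq1⟩ := h.crossing s hs
  have hsub : ({p, q} : Finset E) ⊆ s := by simp [Finset.insert_subset_iff, hp, hq]
  have : Nonempty X := by
    obtain ⟨D, hD⟩ := hne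
    obtain ⟨y, -⟩ := (h.isLevelDisc s hs D hD).exists_mem_edge (h.faces hs) hp hq hp1 hq1
    exact ⟨y⟩
  choose! y hyD hye using fun D hD =>
    (h.isLevelDisc s hs D hD).exists_mem_edge (h.faces hs) hp hq hp1 hq1
  obtain ⟨D, hD, hmin⟩ := exists_min_image (𝒟 s) (fun D => τ.height ℓ (y D)) (h.finite s hs) hne
  refine ⟨D, hD, p, hp, q, hq, hp1, hq1, y D, hyD D hD, by convert hye D hD, fun y' hy' hye' => ?_⟩
  have hye2 : y' ∈ τ.cell {p, q} := by convert hye'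
  obtain ⟨D', hD', hyD'⟩ := h.exists_disc hs hy' (τ.cell_mono hsub hye2)
  rw [(h.isLevelDisc s hs D' hD').eq_of_mem_edge hp hq hp1 hq1 hyD' hye2 (hyD D' hD') (hye D' hD')]
  exact hmin D' hD'

/-- Two tetrahedra with a common point strictly between the extreme heights have a common edge that
joins these heights. -/
theorem exists_common_crossing [DecidableEq E] (h : τ.IsDiscDecomposition ℓ S T 𝒟)
    {s s' : Finset E} (hs : s ∈ T) (hs' : s' ∈ T) {x : X} (hx : x ∈ τ.cell s) (hx' : x ∈ τ.cell s')
    (h1 : τ.height ℓ x ≠ -1) (h2 : τ.height ℓ x ≠ 1) :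
    x ∈ τ.cell (s ∩ s') ∧ s ∩ s' ∈ τ.complex.faces ∧
      ∃ p ∈ s ∩ s', ∃ q ∈ s ∩ s', ℓ p = -1 ∧ ℓ q = 1 := by
  have hu := τ.mem_cell_inter (h.faces hs) (h.faces hs') hx hx'
  have hne : (s ∩ s').Nonempty := by
    rw [Finset.nonempty_iff_ne_empty]
    intro h0
    rw [h0, cell_empty] at hu
    exact hu
  have hface := τ.complex.down_closed (h.faces hs) Finset.inter_subset_left hne
  exact ⟨hu, hface, τ.exists_crossing ℓ (h.height_vertex _ hface) hu h1 h2⟩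

/-- Intersecting discs of two tetrahedra are both lowest or both not: they agree on the common face
of the tetrahedra, which contains an edge that joins the extreme heights. -/
theorem isLowest_of_mem (h : τ.IsDiscDecomposition ℓ S T 𝒟) {s s' : Finset E} (hs : s ∈ T)
    (hs' : s' ∈ T) {D D' : Set X} (hD : D ∈ 𝒟 s) (hD' : D' ∈ 𝒟 s') {x : X} (hx : x ∈ D)
    (hx' : x ∈ D') (hlow : τ.IsLowest ℓ S s D) : τ.IsLowest ℓ S s' D' := by
  classical
  have hDl := h.isLevelDisc s hs D hD
  have hDl' := h.isLevelDisc s' hs' D' hD'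
  obtain ⟨h1, h2⟩ := h.height_ne x (h.subset_surface hs hD hx)
  obtain ⟨hxu, hu, p, hp, q, hq, hp1, hq1⟩ :=
    h.exists_common_crossing hs hs' (hDl.subset_cell hx) (hDl'.subset_cell hx') h1 h2
  rw [Finset.mem_inter] at hp hq
  have hsub : D ∩ τ.cell (s ∩ s') ⊆ D' := by
    refine IsPreconnected.subset_of_mem_of_finite
      (hDl.isPreconnected_inter hu Finset.inter_subset_left) (h.finite s' hs')
      (h.pairwiseDisjoint s' hs') (fun D hD => (h.isLevelDisc s' hs' D hD).isClosed) ?_ hD'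
      ⟨hx, hxu⟩ hx'
    rintro y ⟨hyD, hyu⟩
    exact h.exists_disc hs' (h.subset_surface hs hD hyD)
      (τ.cell_mono Finset.inter_subset_right hyu)
  obtain ⟨y, hy, hye⟩ := hDl.exists_mem_edge (h.faces hs) hp.1 hq.1 hp1 hq1
  have hyu : y ∈ τ.cell (s ∩ s') := τ.cell_mono
    (by simp [Finset.insert_subset_iff, hp, hq]) hye
  refine ⟨p, hp.2, q, hq.2, hp1, hq1, y, hsub ⟨hy, hyu⟩, by convert hye, fun y' hy' hye' => ?_⟩
  exact h.height_le hs hD hlow hp.1 hq.1 hp1 hq1 hy hye hy' (by convert hye')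

theorem isClosed_sUnion_discs (h : τ.IsDiscDecomposition ℓ S T 𝒟) (P : Finset E → Set X → Prop) :
    IsClosed (⋃ s ∈ T, ⋃₀ {D ∈ 𝒟 s | P s D}) := by
  simp only [sUnion_eq_biUnion]
  exact h.finite_tetrahedra.isClosed_biUnion fun s hs =>
    ((h.finite s hs).subset (sep_subset _ _)).isClosed_biUnion fun D hD =>
      (h.isLevelDisc s hs D hD.1).isClosed

/-- The lowest discs form a closed part of the surface, and so do the other ones; if the surface is
connected, then all discs are lowest. -/
theorem isLowest_of_isConnected (h : τ.IsDiscDecomposition ℓ S T 𝒟) (hS : IsConnected S)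
    {s : Finset E} (hs : s ∈ T) {D : Set X} (hD : D ∈ 𝒟 s) : τ.IsLowest ℓ S s D := by
  classical
  set A := ⋃ s ∈ T, ⋃₀ {D ∈ 𝒟 s | τ.IsLowest ℓ S s D}
  set B := ⋃ s ∈ T, ⋃₀ {D ∈ 𝒟 s | ¬ τ.IsLowest ℓ S s D}
  have hcov : S ⊆ A ∪ B := by
    intro x hx
    obtain ⟨s, hs, hxs⟩ := h.exists_tetrahedron x
    obtain ⟨D, hD, hxD⟩ := h.exists_disc hs hx hxs
    by_cases hl : τ.IsLowest ℓ S s D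
    · exact Or.inl (mem_biUnion hs ⟨D, ⟨hD, hl⟩, hxD⟩)
    · exact Or.inr (mem_biUnion hs ⟨D, ⟨hD, hl⟩, hxD⟩)
  have hdis : ∀ x ∈ A, x ∉ B := by
    intro x hxA hxB
    obtain ⟨s, hs, D, ⟨hD, hl⟩, hxD⟩ := mem_iUnion₂.1 hxA
    obtain ⟨s', hs', D', ⟨hD', hl'⟩, hxD'⟩ := mem_iUnion₂.1 hxB
    exact hl' (h.isLowest_of_mem hs hs' hD hD' hxD hxD' hl)
  have hSA : S ⊆ A := by
    rcases isPreconnected_iff_subset_of_disjoint_closed.1 hS.isPreconnected A B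
      (h.isClosed_sUnion_discs _) (h.isClosed_sUnion_discs _) hcov
      (by ext x; simp only [mem_inter_iff, mem_empty_iff_false, iff_false]
          exact fun hx => hdis x hx.2.1 hx.2.2) with hA | hB
    · exact hA
    · exfalso
      obtain ⟨D, hD, hl⟩ := h.exists_isLowest hs ⟨D, hD⟩
      obtain ⟨p, hp, q, hq, hp1, hq1, y, hy, -⟩ := id hl
      exact hdis y (mem_biUnion hs ⟨D, ⟨hD, hl⟩, hy⟩) (hB (h.subset_surface hs hD hy))
  by_contra hl
  obtain ⟨p, hp, q, hq, hp1, hq1⟩ := h.crossing s hs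
  obtain ⟨y, hy, -⟩ := (h.isLevelDisc s hs D hD).exists_mem_edge (h.faces hs) hp hq hp1 hq1
  exact hdis y (hSA (h.subset_surface hs hD hy)) (mem_biUnion hs ⟨D, ⟨hD, hl⟩, hy⟩)

theorem subsingleton_discs (h : τ.IsDiscDecomposition ℓ S T 𝒟) (hS : IsConnected S)
    {s : Finset E} (hs : s ∈ T) : (𝒟 s).Subsingleton := by
  classical
  intro D hD D' hD'
  obtain ⟨p, hp, q, hq, hp1, hq1⟩ := h.crossing s hs
  obtain ⟨y, hy, hye⟩ := (h.isLevelDisc s hs D hD).exists_mem_edge (h.faces hs) hp hq hp1 hq1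
  obtain ⟨y', hy', hye'⟩ := (h.isLevelDisc s hs D' hD').exists_mem_edge (h.faces hs) hp hq hp1 hq1
  have h1 := h.height_le hs hD (h.isLowest_of_isConnected hS hs hD) hp hq hp1 hq1 hy hye
    (h.subset_surface hs hD' hy') hye'
  have h2 := h.height_le hs hD' (h.isLowest_of_isConnected hS hs hD') hp hq hp1 hq1 hy' hye'
    (h.subset_surface hs hD hy) hye
  have heq := τ.height_injOn_edge ℓ hp1 hq1 hye hye' (le_antisymm h1 h2)
  by_contra hne
  exact disjoint_left.1 (h.pairwiseDisjoint s hs hD hD' hne) hy (heq ▸ hy')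

/-- If one of two tetrahedra with a common point at height zero contains a disc, so does
the other one. -/
theorem nonempty_discs_of_mem (h : τ.IsDiscDecomposition ℓ S T 𝒟) {s s' : Finset E} (hs : s ∈ T)
    (hs' : s' ∈ T) {x : X} (hx : x ∈ τ.cell s) (hx' : x ∈ τ.cell s') (h0 : τ.height ℓ x = 0)
    (hne : (𝒟 s).Nonempty) : (𝒟 s').Nonempty := by
  classical
  obtain ⟨D, hD⟩ := hne
  obtain ⟨-, -, p, hp, q, hq, hp1, hq1⟩ :=
    h.exists_common_crossing hs hs' hx hx' (by rw [h0]; norm_num) (by rw [h0]; norm_num)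
  rw [Finset.mem_inter] at hp hq
  obtain ⟨y, hy, hye⟩ := (h.isLevelDisc s hs D hD).exists_mem_edge (h.faces hs) hp.1 hq.1 hp1 hq1
  obtain ⟨D', hD', -⟩ := h.exists_disc hs' (h.subset_surface hs hD hy)
    (τ.cell_mono (by simp [Finset.insert_subset_iff, hp.2, hq.2]) hye)
  exact ⟨D', hD'⟩

theorem nonempty_discs (h : τ.IsDiscDecomposition ℓ S T 𝒟) (hS : S.Nonempty)
    (hZ : IsPreconnected (τ.zeroLevel ℓ)) {s : Finset E} (hs : s ∈ T) : (𝒟 s).Nonempty := by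
  classical
  set A := ⋃ s ∈ {s ∈ T | (𝒟 s).Nonempty}, τ.cell s
  set B := ⋃ s ∈ {s ∈ T | ¬ (𝒟 s).Nonempty}, τ.cell s
  have hA : IsClosed A := (h.finite_tetrahedra.subset (sep_subset _ _)).isClosed_biUnion
    fun s _ => τ.isClosed_cell s
  have hB : IsClosed B := (h.finite_tetrahedra.subset (sep_subset _ _)).isClosed_biUnion
    fun s _ => τ.isClosed_cell s
  have hcov : τ.zeroLevel ℓ ⊆ A ∪ B := by
    intro x _
    obtain ⟨s, hs, hxs⟩ := h.exists_tetrahedron x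
    by_cases hne : (𝒟 s).Nonempty
    · exact Or.inl (mem_biUnion (show s ∈ {s ∈ T | (𝒟 s).Nonempty} from ⟨hs, hne⟩) hxs)
    · exact Or.inr (mem_biUnion (show s ∈ {s ∈ T | ¬ (𝒟 s).Nonempty} from ⟨hs, hne⟩) hxs)
  have hdis : ∀ x ∈ τ.zeroLevel ℓ, x ∈ A → x ∉ B := by
    intro x hx hxA hxB
    obtain ⟨s, ⟨hs, hne⟩, hxs⟩ := mem_iUnion₂.1 hxA
    obtain ⟨s', ⟨hs', hne'⟩, hxs'⟩ := mem_iUnion₂.1 hxB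
    exact hne' (h.nonempty_discs_of_mem hs hs' hxs hxs' hx hne)
  have hzero : ∀ s ∈ T, ∃ z ∈ τ.zeroLevel ℓ, z ∈ τ.cell s := by
    intro s hs
    obtain ⟨p, hp, q, hq, hp1, hq1⟩ := h.crossing s hs
    obtain ⟨z, hz, hz0⟩ := τ.exists_mem_zeroLevel_edge ℓ
      (τ.pair_mem_faces (h.faces hs) hp hq) hp1 hq1
    exact ⟨z, hz0, τ.cell_mono (by simp [Finset.insert_subset_iff, hp, hq]) hz⟩
  obtain ⟨z, hz0, hzs⟩ := hzero s hs
  by_contra hne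
  have hzB : z ∈ B := mem_biUnion (show s ∈ {s ∈ T | ¬ (𝒟 s).Nonempty} from ⟨hs, hne⟩) hzs
  rcases isPreconnected_iff_subset_of_disjoint_closed.1 hZ A B hA hB hcov
      (by ext x; simp only [mem_inter_iff, mem_empty_iff_false, iff_false]
          exact fun hx => hdis x hx.1 hx.2.1 hx.2.2) with hZA | hZB
  · exact hdis z hz0 (hZA hz0) hzB
  · obtain ⟨x, hx⟩ := hS
    obtain ⟨s', hs', hxs'⟩ := h.exists_tetrahedron x
    obtain ⟨D, hD, -⟩ := h.exists_disc hs' hx hxs'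
    obtain ⟨z', hz0', hzs'⟩ := hzero s' hs'
    exact hdis z' hz0' (mem_biUnion (show s' ∈ {s ∈ T | (𝒟 s).Nonempty} from ⟨hs', D, hD⟩) hzs')
      (hZB hz0')

end IsDiscDecomposition

/-- A connected normal surface that avoids the extreme heights is normally isotopic to the zero
level, if the latter is connected. -/
theorem IsNormalSurface.normallyIsotopic_zeroLevel [CompactSpace X] [T2Space X]
    {τ : Triangulation E X} (ℓ : E →L[ℝ] ℝ) {S : Set X} (hS : τ.IsNormalSurface S)
    (hℓ : ∀ u ∈ τ.complex.faces, ∀ p ∈ u, ℓ p = -1 ∨ ℓ p = 1)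
    (htet : ∀ u ∈ τ.complex.faces, ∃ s ∈ τ.complex.faces, s.card = 4 ∧ u ⊆ s)
    (hcross : ∀ s ∈ τ.complex.faces, s.card = 4 → ∃ p ∈ s, ∃ q ∈ s, ℓ p = -1 ∧ ℓ q = 1)
    (havoid : ∀ x ∈ S, τ.height ℓ x ≠ -1 ∧ τ.height ℓ x ≠ 1)
    (hconn : IsConnected S) (hZ : IsPreconnected (τ.zeroLevel ℓ)) :
    τ.NormallyIsotopic S (τ.zeroLevel ℓ) := by
  choose! 𝒟 hfin hdis hdisc hunion using hS
  have h : τ.IsDiscDecomposition ℓ S {s ∈ τ.complex.faces | s.card = 4} 𝒟 := by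
    refine ⟨sep_subset _ _, fun u hu => ?_, hℓ, fun s hs => hcross s hs.1 hs.2, havoid,
      fun s hs => hfin s hs.1 hs.2, fun s hs => hdis s hs.1 hs.2, fun s hs D hD => ?_,
      fun s hs => hunion s hs.1 hs.2⟩
    · obtain ⟨s, hs, h4, hus⟩ := htet u hu
      exact ⟨s, ⟨hs, h4⟩, hus⟩
    · refine (hdisc s hs.1 hs.2 D hD).isLevelDisc hs.1 hs.2 (hℓ s hs.1) fun x hx => ?_
      exact havoid x ((hunion s hs.1 hs.2).symm.subset ⟨D, hD, hx⟩).1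
  refine τ.normallyIsotopic_of_cellwise (ℓ : E →ₗ[ℝ] ℝ) hℓ rfl fun u hu => ?_
  obtain ⟨s, hs, hus⟩ := h.covers u hu
  obtain ⟨D, hD⟩ := h.nonempty_discs hconn.nonempty hZ hs
  have hSD : S ∩ τ.cell s = D := by
    rw [h.inter_cell s hs, (h.subsingleton_discs hconn hs).eq_singleton_of_mem hD, sUnion_singleton]
  obtain ⟨g, hg, hgD⟩ := h.isLevelDisc s hs D hD
  refine ⟨s, hs.1, hus, g.symm, fun v hv x => ?_, fun x => ?_⟩
  · rw [← hg v hv, g.apply_symm_apply]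
  · have hx : (x : X) ∈ S ↔ (x : X) ∈ D := by
      rw [← hSD]; exact ⟨fun h => ⟨h, x.2⟩, fun h => h.1⟩
    rw [hx, hgD]
    constructor
    · rintro ⟨_, ⟨z, hz, rfl⟩, hzx⟩
      rw [← Subtype.ext hzx]
      simpa using hz
    · exact fun hz => ⟨x, ⟨g.symm x, hz, by simp⟩, rfl⟩

end Triangulation

/-! ### The prism triangulation -/

variable {E F : Type*} [NormedAddCommGroup E] [NormedSpace ℝ E]

/-- A simplex of the prism triangulation is a face of a tetrahedron with vertices at both
extreme heights. -/
theorem exists_tetrahedron_of_mem_prismFaces {K : Geometry.SimplicialComplex ℝ E}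
    (o : EdgeOrientation K) {u : Finset (E × ℝ)} (hu : u ∈ prismFaces o) :
    ∃ s ∈ prismFaces o, s.card = 4 ∧ u ⊆ s ∧ ∃ p ∈ s, ∃ q ∈ s, p.2 = -1 ∧ q.2 = 1 := by
  classical
  obtain ⟨-, t, v₀, v₁, v₂, ho, h⟩ := hu
  obtain ⟨ht, h3, htv, -⟩ := id ho
  have htf : t = {v₀, v₁, v₂} := Finset.coe_injective (by rw [htv]; simp)
  have h01 : v₀ ≠ v₁ := by
    rintro rfl
    have := Finset.card_le_two (a := v₀) (b := v₂)
    simp [htf] at h3; omega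
  have h02 : v₀ ≠ v₂ := by
    rintro rfl
    have := Finset.card_le_two (a := v₁) (b := v₀)
    simp [htf] at h3; omega
  have h12 : v₁ ≠ v₂ := by
    rintro rfl
    have := Finset.card_le_two (a := v₀) (b := v₁)
    simp [htf] at h3; omega
  have hne : (-1 : ℝ) ≠ 1 := by norm_num
  have key : ∀ a b c d : E × ℝ, a ≠ b → a ≠ c → a ≠ d → b ≠ c → b ≠ d → c ≠ d →
      a.2 = -1 → d.2 = 1 → ((u : Set (E × ℝ)) ⊆ {a, b, c, d}) →
      (({a, b, c, d} : Set (E × ℝ)) = prismTet₀ v₀ v₁ v₂ ∨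
        ({a, b, c, d} : Set (E × ℝ)) = prismTet₁ v₀ v₁ v₂ ∨
        ({a, b, c, d} : Set (E × ℝ)) = prismTet₂ v₀ v₁ v₂) →
      ∃ s ∈ prismFaces o, s.card = 4 ∧ u ⊆ s ∧ ∃ p ∈ s, ∃ q ∈ s, p.2 = -1 ∧ q.2 = 1 := by
    intro a b c d hab hac had hbc hbd hcd ha hd hu hT
    refine ⟨{a, b, c, d}, ⟨by simp, t, v₀, v₁, v₂, ho, ?_⟩, ?_, ?_, a, by simp, d, by simp, ha, hd⟩
    · rw [show (({a, b, c, d} : Finset (E × ℝ)) : Set (E × ℝ)) = {a, b, c, d} by simp]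
      exact hT.imp Eq.subset (Or.imp Eq.subset Eq.subset)
    · exact Finset.card_eq_four.2 ⟨a, b, c, d, hab, hac, had, hbc, hbd, hcd, rfl⟩
    · rw [← Finset.coe_subset]; simpa using hu
  rcases h with h | h | h
  · exact key _ _ _ _ (by simp [hne]) (by simp [hne]) (by simp [hne]) (by simp [h01])
      (by simp [h02]) (by simp [h12]) rfl rfl h (Or.inl rfl)
  · exact key _ _ _ _ (by simp [h01]) (by simp [hne]) (by simp [hne]) (by simp [hne])
      (by simp [hne]) (by simp [h12]) rfl rfl h (Or.inr (Or.inl rfl))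
  · exact key _ _ _ _ (by simp [h01]) (by simp [h02]) (by simp [hne]) (by simp [h12])
      (by simp [hne]) (by simp [hne]) rfl rfl h (Or.inr (Or.inr rfl))

theorem height_prismTriangulation [TopologicalSpace F] (τ : SurfaceTriangulation E F)
    (o : EdgeOrientation τ.complex) (ho : o.NoCyclicTriangle) (x : F × Icc (-1 : ℝ) 1) :
    (prismTriangulation τ o ho).height (ContinuousLinearMap.snd ℝ E ℝ) x = x.2 := rfl

end NormalSurfaces

open NormalSurfaces in
/-- `F` is a closed connected surface, triangulated by `τ`, and `o` orients the edges of `τ` without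
cyclic triangles. A normal surface `S` in the prism triangulation of `F × [-1, 1]` is properly
embedded, that is, its boundary is its intersection with `F × {-1, 1}`, so it is a closed surface
exactly when it is disjoint from `F × {-1, 1}`. -/
theorem theorem3p3 {F E : Type*} [TopologicalSpace F] [T2Space F] [CompactSpace F]
    [ConnectedSpace F] [ChartedSpace (EuclideanSpace ℝ (Fin 2)) F]
    [NormedAddCommGroup E] [NormedSpace ℝ E]
    (τ : SurfaceTriangulation E F) (o : EdgeOrientation τ.complex) (ho : o.NoCyclicTriangle)
    (S : Set (F × Set.Icc (-1 : ℝ) 1))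
    (hnormal : (prismTriangulation τ o ho).IsNormalSurface S)
    (hclosed : Disjoint S {p | (p.2 : ℝ) = -1 ∨ (p.2 : ℝ) = 1})
    (hconn : IsConnected S) :
    (prismTriangulation τ o ho).NormallyIsotopic S {p | (p.2 : ℝ) = 0} := by
  refine hnormal.normallyIsotopic_zeroLevel (ContinuousLinearMap.snd ℝ E ℝ) ?_ ?_ ?_ ?_ hconn ?_
  · intro u hu p hp
    obtain ⟨t, -, h, -⟩ := prismFaces_spec o hu
    exact (h p hp).2
  · intro u hu
    obtain ⟨s, hs, h4, hus, -⟩ := exists_tetrahedron_of_mem_prismFaces o hu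
    exact ⟨s, hs, h4, hus⟩
  · intro u hu h4
    obtain ⟨s, -, h4', hus, h⟩ := exists_tetrahedron_of_mem_prismFaces o hu
    obtain rfl := Finset.eq_of_subset_of_card_le hus (by omega)
    exact h
  · intro x hx
    rw [height_prismTriangulation]
    exact ⟨fun h => Set.disjoint_left.1 hclosed hx (Or.inl h),
      fun h => Set.disjoint_left.1 hclosed hx (Or.inr h)⟩
  · -- The zero level is the image of `F` under `x ↦ (x, 0)`.
    have himage : (prismTriangulation τ o ho).zeroLevel (ContinuousLinearMap.snd ℝ E ℝ) =
        Set.range fun x : F => (x, (⟨0, by norm_num⟩ : Set.Icc (-1 : ℝ) 1)) := by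
      ext ⟨x, r⟩
      constructor
      · exact fun h => ⟨x, Prod.ext rfl (Subtype.ext (Eq.symm h))⟩
      · rintro ⟨y, hy⟩
        exact (congrArg (fun p : F × Set.Icc (-1 : ℝ) 1 => (p.2 : ℝ)) hy).symm
    rw [himage]
    exact isPreconnected_range (by fun_prop)
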